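/- **Theorem 2.8 (one-matrix rectangular antisymmetric Cayley identity).** Let $0\le m\le n$ be integers, let $X=(x_{ij})$ be a $2m\times 2n$ matrix of indeterminates, and let $\partial=(\partial/\partial x_{ij})$ be the corresponding matrix of partial derivatives. Let $J$ be the $2n\times 2n$ block-diagonal matrix with $n$ diagonal blocks $\begin{pmatrix}0&1\\-1&0\end{pmatrix}$. For a $2N\times 2N$ antisymmetric matrix $A$ (zero diagonal included) with commuting entries put $\operatorname{pf}A=\sum_\sigma \operatorname{sgn}(\sigma)\,a_{\sigma(1)\sigma(2)}\cdots a_{\sigma(2N-1)\sigma(2N)}$, the sum being over the permutations $\sigma$ of $[2N]=\{1,\dots,2N\}$ with $\sigma(2r-1)<\sigma(2r)$ for all $r$ and $\sigma(1)<\sigma(3)<\cdots<\sigma(2N-1)$. For $I\subseteq[2m]$ let $A_{II}$ be the submatrix of $A$ with rows and columns in $I$ (in their original order), $I^c=[2m]\setminus I$, and $\epsilon(I)=(-1)^{|I|(|I|-1)/2}(-1)^{\sum_{i\in I}i}$. Write $P=\operatorname{pf}(XJX^{\mathrm T})$. Then $$\operatorname{pf}(\partial J\partial^{\mathrm T})\,P^s=\Bigl(\prod_{j=0}^{m-1}(s+2j)(s+2n-2m+1+2j)\Bigr)P^{s-1},$$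 and more generally, for every $k\ge 0$ and every $I\subseteq[2m]$ with $|I|=2k$, $$\operatorname{pf}[(\partial J\partial^{\mathrm T})_{II}]\,P^s=\Bigl(\prod_{j=0}^{k-1}(s+2j)(s+2n-2m+1+2j)\Bigr)P^{s-1}\,\epsilon(I)\,\operatorname{pf}[(XJX^{\mathrm T})_{I^cI^c}].$$ These identities hold in each of the following senses: 1. for every integer $s\ge1$, in the polynomial ring $R[x]$ over any commutative ring $R$; 2. for every integer $s$, in the field $K(x)$ of rational fractions over any field $K$; 3. for an indeterminate $s$ and any field $K$ of characteristic $0$, in the free rank-one $K[x,s,P^{-1}]$-module $K[x,s,P^{-1}]P^s$ on the symbol $P^s$, where $\partial/\partial x_{ij}$ acts by $\frac{\partial}{\partial x_{ij}}(fP^s)=\bigl(\frac{\partial f}{\partial x_{ij}}+s\,f\,\frac{\partial P}{\partial x_{ij}}P^{-1}\bigr)P^s$ and $P^{s-1}$ means $P^{-1}P^s$; 4. for every complex $s$, every open set $U$ of real or of complex $2m\times2n$ matrices, and every branch of $P^s$ on $U$, that is, every continuous $F:U\to\mathbb C$ such that for each $x\in U$ there is $L\in\mathbb C$ with $e^{L}=P(x)$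 and $F(x)=e^{sL}$ (so $P$ has no zero in $U$). Such an $F$ is analytic on $U$, and the identities hold at every point of $U$ with $P^s=F$ and $P^{s-1}=F/P$. -/

import Mathlib

open scoped BigOperators

namespace RectCayley

noncomputable section

/-! ### Pfaffians, principal submatrices, signs, the symplectic form -/

/-- The position `2r` (that is, `2r + 1` in one-based numbering) among `0, …, 2N - 1`. -/
def evenPos {N : ℕ} (r : Fin N) : Fin (2 * N) := ⟨2 * r.1, by omega⟩

/-- The position `2r + 1` (that is, `2r + 2` in one-based numbering) among `0, …, 2N - 1`. -/
def oddPos {N : ℕ} (r : Fin N) : Fin (2 * N) := ⟨2 * r.1 + 1, by omega⟩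

/-- The permutations `σ` of `2N` letters with `σ(1) < σ(2)`, `σ(3) < σ(4)`, … and
`σ(1) < σ(3) < σ(5) < ⋯`.  They correspond to the perfect matchings
`{σ(1)σ(2), σ(3)σ(4), …}` of the `2N` letters. -/
def matchingPerms (N : ℕ) : Finset (Equiv.Perm (Fin (2 * N))) :=
  Finset.univ.filter fun σ =>
    (∀ r : Fin N, σ (evenPos r) < σ (oddPos r)) ∧
      ∀ r r' : Fin N, r < r' → σ (evenPos r) < σ (evenPos r')

/-- The pfaffian `∑_σ sgn(σ) a_{σ(1)σ(2)} ⋯ a_{σ(2N-1)σ(2N)}` of a `2N × 2N` matrix, the sum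
running over perfect matchings.  The ring is not required to be commutative, so that the matrix
entries may be differential operators; the factors are multiplied in the order of the pairs, and
the order is immaterial as soon as the entries commute with each other, which is the case for
every matrix used below. -/
def pf {A : Type*} [Ring A] {N : ℕ} (M : Matrix (Fin (2 * N)) (Fin (2 * N)) A) : A :=
  ∑ σ ∈ matchingPerms N,
    ((Equiv.Perm.sign σ : ℤ) : A) *
      (List.ofFn fun r : Fin N => M (σ (evenPos r)) (σ (oddPos r))).prod

/-- The submatrix `M_{II}`, the rows and columns being kept in their original order. -/
def principal {A : Type*} {N l : ℕ} (M : Matrix (Fin N) (Fin N) A) (I : Finset (Fin N))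
    (h : I.card = l) : Matrix (Fin l) (Fin l) A :=
  M.submatrix (I.orderEmbOfFin h) (I.orderEmbOfFin h)

theorem card_compl_eq {m k : ℕ} {I : Finset (Fin (2 * m))} (h : I.card = 2 * k) :
    Iᶜ.card = 2 * (m - k) := by
  rw [Finset.card_compl, Fintype.card_fin, h]
  omega

/-- `ε(I) = (-1)^{|I|(|I|-1)/2} (-1)^{∑_{i ∈ I} i}`, where the indices `i` are counted from `1`. -/
def eps {N : ℕ} (I : Finset (Fin N)) : ℤ :=
  (-1) ^ (I.card * (I.card - 1) / 2) * (-1) ^ (∑ i ∈ I, (i.1 + 1))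

/-- The standard `2n × 2n` symplectic form, block diagonal with blocks `(0, 1; -1, 0)`. -/
def symplJ (A : Type*) [Ring A] (n : ℕ) : Matrix (Fin (2 * n)) (Fin (2 * n)) A :=
  Matrix.of fun i j =>
    if i.1 % 2 = 0 ∧ j.1 = i.1 + 1 then 1
    else if j.1 % 2 = 0 ∧ i.1 = j.1 + 1 then -1
    else 0

/-- `Y J Yᵀ` for a `2m × 2n` matrix `Y`. -/
def symplProd {A : Type*} [Ring A] {m n : ℕ} (Y : Matrix (Fin (2 * m)) (Fin (2 * n)) A) :
    Matrix (Fin (2 * m)) (Fin (2 * m)) A :=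
  Y * symplJ A n * Y.transpose

/-- The index set of the indeterminates `x_{ij}`. -/
abbrev Idx (m n : ℕ) : Type := Fin (2 * m) × Fin (2 * n)

/-- The matrix whose entries are the members of a family indexed by pairs `(i, j)`. -/
def matrixOf {A : Type*} {m n : ℕ} (D : Idx m n → A) : Matrix (Fin (2 * m)) (Fin (2 * n)) A :=
  Matrix.of fun i j => D (i, j)

/-- `∏_{j=0}^{k-1} (s + 2j)(s + 2n - 2m + 1 + 2j)`. -/
def cayleyFactor {A : Type*} [CommRing A] (s : A) (m n k : ℕ) : A :=
  ∏ j ∈ Finset.range k, (s + 2 * (j : A)) * (s + 2 * (n : A) - 2 * (m : A) + 1 + 2 * (j : A))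

/-! ### The matrices of indeterminates and of partial derivatives over a polynomial ring -/

/-- The matrix `X` of indeterminates over `R[x]`. -/
def polyX (R : Type*) [CommRing R] (m n : ℕ) :
    Matrix (Fin (2 * m)) (Fin (2 * n)) (MvPolynomial (Idx m n) R) :=
  matrixOf fun p => MvPolynomial.X p

/-- The matrix `∂` of partial derivatives, acting on `R[x]`. -/
def polyD (R : Type*) [CommRing R] (m n : ℕ) :
    Matrix (Fin (2 * m)) (Fin (2 * n)) (Module.End R (MvPolynomial (Idx m n) R)) :=
  matrixOf fun p => (MvPolynomial.pderiv p).toLinearMap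

/-! ### Partial derivatives on localizations of polynomial rings -/

/-- For a derivation `d` of `A` and a localization `S` of `A`: the ring homomorphism
`f ↦ f + ε d(f)` from `S` to `S[ε]/(ε²)`, where `d(f)` is the unique extension of `d` to `S`.
It extends the ring homomorphism `a ↦ a + ε d(a)` from `A` to `S[ε]/(ε²)`. -/
def locHom {A S : Type*} [CommRing A] [CommRing S] [Algebra A S] (M : Submonoid A)
    [IsLocalization M S] (d : Derivation ℤ A A) : S →+* TrivSqZeroExt S S :=
  IsLocalization.lift (M := M)
    (g :=
      { toFun := fun a => TrivSqZeroExt.inl (algebraMap A S a) +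
          TrivSqZeroExt.inr (algebraMap A S (d a))
        map_one' := by ext <;> simp
        map_zero' := by ext <;> simp
        map_add' := fun a b => by
          rw [map_add, map_add, map_add, TrivSqZeroExt.inl_add, TrivSqZeroExt.inr_add]
          abel
        map_mul' := fun a b => by
          apply TrivSqZeroExt.ext
          · simp
          · simp only [TrivSqZeroExt.snd_add, TrivSqZeroExt.snd_mul, TrivSqZeroExt.snd_inl,
              TrivSqZeroExt.snd_inr, TrivSqZeroExt.fst_add, TrivSqZeroExt.fst_inl,
              TrivSqZeroExt.fst_inr, Derivation.leibniz, smul_eq_mul, map_add, map_mul,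
              MulOpposite.smul_eq_mul_unop, MulOpposite.unop_op, add_zero, zero_add]
            ring })
    (fun y => by
      rw [TrivSqZeroExt.isUnit_iff_isUnit_fst]
      simpa using IsLocalization.map_units S y)

theorem locHom_algebraMap {A S : Type*} [CommRing A] [CommRing S] [Algebra A S]
    (M : Submonoid A) [IsLocalization M S] (d : Derivation ℤ A A) (a : A) :
    locHom (S := S) M d (algebraMap A S a) =
      TrivSqZeroExt.inl (algebraMap A S a) + TrivSqZeroExt.inr (algebraMap A S (d a)) := by
  simp [locHom, IsLocalization.lift_eq]

theorem locHom_fst {A S : Type*} [CommRing A] [CommRing S] [Algebra A S] (M : Submonoid A)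
    [IsLocalization M S] (d : Derivation ℤ A A) (f : S) : (locHom M d f).fst = f := by
  have h : ((TrivSqZeroExt.fstHom S S S : TrivSqZeroExt S S →+* S).comp (locHom M d)) =
      RingHom.id S := by
    apply IsLocalization.ringHom_ext M
    ext a
    simp [locHom_algebraMap]
  exact congrArg (fun φ : S →+* S => φ f) h

/-- The extension of the partial derivative `∂/∂x_i` from `R[x]` to a localization of `R[x]`. -/
def locPartial {R σ S : Type*} [CommRing R] [CommRing S] [Algebra (MvPolynomial σ R) S]
    [Algebra R S] [IsScalarTower R (MvPolynomial σ R) S] (M : Submonoid (MvPolynomial σ R))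
    [IsLocalization M S] (i : σ) : Derivation R S S :=
  Derivation.mk'
    { toFun := fun f => (locHom M ((MvPolynomial.pderiv i).restrictScalars ℤ) f).snd
      map_add' := fun f g => by simp
      map_smul' := fun c f => by
        have h : algebraMap R S c = algebraMap (MvPolynomial σ R) S (MvPolynomial.C c) :=
          IsScalarTower.algebraMap_apply R (MvPolynomial σ R) S c
        rw [Algebra.smul_def, map_mul, h, locHom_algebraMap, TrivSqZeroExt.snd_mul]
        simp [locHom_fst, Algebra.smul_def, h] }
    (fun f g => by simp [locHom_fst, mul_comm])

theorem locPartial_algebraMap {R σ S : Type*} [CommRing R] [CommRing S]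
    [Algebra (MvPolynomial σ R) S] [Algebra R S] [IsScalarTower R (MvPolynomial σ R) S]
    (M : Submonoid (MvPolynomial σ R)) [IsLocalization M S] (i : σ) (p : MvPolynomial σ R) :
    locPartial (S := S) M i (algebraMap (MvPolynomial σ R) S p) =
      algebraMap (MvPolynomial σ R) S (MvPolynomial.pderiv i p) := by
  change (locHom (S := S) M ((MvPolynomial.pderiv i).restrictScalars ℤ)
    (algebraMap (MvPolynomial σ R) S p)).snd = _
  rw [locHom_algebraMap, TrivSqZeroExt.snd_add, TrivSqZeroExt.snd_inl, TrivSqZeroExt.snd_inr,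
    zero_add]
  rfl

/-- `∂/∂x_i` as an operator on the field `K(x)` of rational fractions. -/
def ratPartial (K : Type*) [Field K] {σ : Type*} (i : σ) :
    Module.End K (FractionRing (MvPolynomial σ K)) :=
  (locPartial (nonZeroDivisors (MvPolynomial σ K)) i).toLinearMap

/-- The matrix `X` of indeterminates over `K(x)`. -/
def ratX (K : Type*) [Field K] (m n : ℕ) :
    Matrix (Fin (2 * m)) (Fin (2 * n)) (FractionRing (MvPolynomial (Idx m n) K)) :=
  matrixOf fun p => algebraMap (MvPolynomial (Idx m n) K) _ (MvPolynomial.X p)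

/-- The matrix `∂` of partial derivatives, acting on `K(x)`. -/
def ratD (K : Type*) [Field K] (m n : ℕ) :
    Matrix (Fin (2 * m)) (Fin (2 * n))
      (Module.End K (FractionRing (MvPolynomial (Idx m n) K))) :=
  matrixOf fun p => ratPartial K p

/-! ### Powers with symbolic exponent

Here `R = K[s]`, and `P` is a polynomial in the indeterminates `x` over `K[s]` (below, it
does not involve `s`).  `K[x, s, P⁻¹]` is `Localization.Away P`. -/

/-- The free `K[x, s, P⁻¹]`-module of rank one `K[x, s, P⁻¹] P^s`; the element `f P^s` is
represented by `f`. -/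
def PowModule {K σ : Type*} [Field K] (P : MvPolynomial σ (Polynomial K)) : Type _ :=
  Localization.Away P

section PowModule

variable {K σ : Type*} [Field K] (P : MvPolynomial σ (Polynomial K))

instance : AddCommGroup (PowModule P) := inferInstanceAs (AddCommGroup (Localization.Away P))

instance : Module (Localization.Away P) (PowModule P) :=
  inferInstanceAs (Module (Localization.Away P) (Localization.Away P))

instance : Module (Polynomial K) (PowModule P) :=
  inferInstanceAs (Module (Polynomial K) (Localization.Away P))

/-- The element `f P^s` of `K[x, s, P⁻¹] P^s`. -/
def PowModule.of (f : Localization.Away P) : PowModule P := f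

/-- The element `s` of `K[x, s, P⁻¹]`. -/
def symS : Localization.Away P :=
  algebraMap (MvPolynomial σ (Polynomial K)) (Localization.Away P)
    (MvPolynomial.C Polynomial.X)

/-- The formal differentiation `∂/∂x_i (f P^s) = (∂f/∂x_i + s f (∂P/∂x_i) P⁻¹) P^s`. -/
def symPartial (i : σ) : Module.End (Polynomial K) (PowModule P) :=
  show Module.End (Polynomial K) (Localization.Away P) from
    (locPartial (Submonoid.powers P) i).toLinearMap +
      LinearMap.mulLeft (Polynomial K)
        (symS P * algebraMap _ (Localization.Away P) (MvPolynomial.pderiv i P) *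
          IsLocalization.Away.invSelf P)

theorem symPartial_of (i : σ) (f : Localization.Away P) :
    symPartial P i (PowModule.of P f) =
      PowModule.of P (locPartial (Submonoid.powers P) i f +
        symS P * algebraMap _ (Localization.Away P) (MvPolynomial.pderiv i P) *
          IsLocalization.Away.invSelf P * f) := rfl

end PowModule

/-- The polynomial `P = pf (X J Xᵀ)`, as an element of `K[s][x]`. -/
def symP (K : Type*) [Field K] (m n : ℕ) : MvPolynomial (Idx m n) (Polynomial K) :=
  pf (symplProd (polyX (Polynomial K) m n))

/-- The matrix `X` of indeterminates over `K[x, s, P⁻¹]`, where `P = pf (X J Xᵀ)`. -/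
def symX (K : Type*) [Field K] (m n : ℕ) :
    Matrix (Fin (2 * m)) (Fin (2 * n)) (Localization.Away (symP K m n)) :=
  matrixOf fun p => algebraMap (MvPolynomial (Idx m n) (Polynomial K)) _ (MvPolynomial.X p)

/-- The matrix `∂` of partial derivatives, acting on `K[x, s, P⁻¹] P^s`, where
`P = pf (X J Xᵀ)`. -/
def symD (K : Type*) [Field K] (m n : ℕ) :
    Matrix (Fin (2 * m)) (Fin (2 * n)) (Module.End (Polynomial K) (PowModule (symP K m n))) :=
  matrixOf fun p => symPartial (symP K m n) p

/-! ### Analytic functions on an open set, and branches of powers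

The variables run over an open subset `U` of `𝕜^σ`, and functions are complex-valued. -/

section Analytic

variable {𝕜 : Type*} [RCLike 𝕜] {σ : Type*}

/-- Extension by zero of a function on `U`. -/
def extZero {U : TopologicalSpace.Opens (σ → 𝕜)} (g : U → ℂ) : (σ → 𝕜) → ℂ :=
  Function.extend Subtype.val g 0

theorem extZero_add {U : TopologicalSpace.Opens (σ → 𝕜)} (f g : U → ℂ) :
    extZero (f + g) = extZero f + extZero g := by
  simpa [extZero] using Function.extend_add (Subtype.val : U → (σ → 𝕜)) f g 0 0

theorem extZero_smul [NormedAlgebra 𝕜 ℂ] {U : TopologicalSpace.Opens (σ → 𝕜)} (c : 𝕜) (g : U → ℂ) :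
    extZero (c • g) = c • extZero g := by
  simpa [extZero] using Function.extend_smul c (Subtype.val : U → (σ → 𝕜)) g 0

theorem extZero_apply {U : TopologicalSpace.Opens (σ → 𝕜)} (g : U → ℂ) (x : U) :
    extZero g x.1 = g x :=
  Subtype.val_injective.extend_apply g 0 x

/-- The space of analytic functions on the open set `U`. -/
def analyticFun [NormedAlgebra 𝕜 ℂ] [Fintype σ] (U : TopologicalSpace.Opens (σ → 𝕜)) : Submodule 𝕜 (U → ℂ) where
  carrier := {g | AnalyticOnNhd 𝕜 (extZero g) U}
  add_mem' := fun {f g} hf hg => by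
    simpa only [Set.mem_ofPred_eq, extZero_add] using AnalyticOnNhd.add hf hg
  zero_mem' := by
    have h : extZero (0 : U → ℂ) = 0 := by
      simpa using extZero_smul (0 : 𝕜) (0 : U → ℂ)
    change AnalyticOnNhd 𝕜 (extZero (0 : U → ℂ)) U
    rw [h]
    exact (analyticOnNhd_const : AnalyticOnNhd 𝕜 (fun _ : σ → 𝕜 => (0 : ℂ)) U)
  smul_mem' := fun c g hg => by
    simpa only [Set.mem_ofPred_eq, extZero_smul] using AnalyticOnNhd.const_smul (c := c) hg

/-- The function `∂g/∂x_i` on `U`. -/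
def partialFun [NormedAlgebra 𝕜 ℂ] [Fintype σ] [DecidableEq σ] {U : TopologicalSpace.Opens (σ → 𝕜)} (i : σ) (g : U → ℂ) : U → ℂ :=
  fun x => fderiv 𝕜 (extZero g) x.1 (Pi.single i 1)

/-- `∂/∂x_i` as an operator on the analytic functions on `U`. -/
def anPartial [NormedAlgebra 𝕜 ℂ] [Fintype σ] [DecidableEq σ] (U : TopologicalSpace.Opens (σ → 𝕜)) (i : σ) :
    Module.End 𝕜 (analyticFun U) where
  toFun := fun g => ⟨partialFun i g.1, by
    have h1 : AnalyticOnNhd 𝕜 (fun x => fderiv 𝕜 (extZero g.1) x (Pi.single i 1)) U :=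
      fun x hx => ((ContinuousLinearMap.apply 𝕜 ℂ (Pi.single i (1 : 𝕜) : σ → 𝕜)).analyticAt
        _).comp (AnalyticOnNhd.fderiv g.2 x hx)
    refine h1.congr U.isOpen fun x hx => ?_
    exact (extZero_apply (partialFun i g.1) ⟨x, hx⟩).symm⟩
  map_add' := fun f g => by
    ext x
    change fderiv 𝕜 (extZero (f.1 + g.1)) x.1 _ = _
    rw [extZero_add, fderiv_add (f.2 x.1 x.2).differentiableAt (g.2 x.1 x.2).differentiableAt]
    rfl
  map_smul' := fun c g => by
    ext x
    change fderiv 𝕜 (extZero (c • g.1)) x.1 _ = _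
    rw [extZero_smul, fderiv_const_smul (g.2 x.1 x.2).differentiableAt]
    rfl

/-- `F` is a branch of `P^s` on `U`: a continuous function whose value at each point `x` is one
of the values `exp (s log P(x))` of the power.  (So `P` has no zero in `U`.) -/
def IsPowBranch {U : TopologicalSpace.Opens (σ → 𝕜)} (P : U → ℂ) (s : ℂ) (F : U → ℂ) : Prop :=
  Continuous F ∧ ∀ x, ∃ L : ℂ, Complex.exp L = P x ∧ F x = Complex.exp (s * L)

end Analytic

/-- The `2m × 2n` matrix with entries `x_{ij} ∈ 𝕜`, read as a complex matrix. -/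
def anX {𝕜 : Type*} [RCLike 𝕜] [NormedAlgebra 𝕜 ℂ] {m n : ℕ} (x : Idx m n → 𝕜) :
    Matrix (Fin (2 * m)) (Fin (2 * n)) ℂ :=
  matrixOf fun p => algebraMap 𝕜 ℂ (x p)

/-- The function `P = pf (X J Xᵀ)` on the open set `U` of `2m × 2n` matrices. -/
def anP {𝕜 : Type*} [RCLike 𝕜] [NormedAlgebra 𝕜 ℂ] {m n : ℕ}
    (U : TopologicalSpace.Opens (Idx m n → 𝕜)) : U → ℂ :=
  fun x => pf (symplProd (anX x.1))

/-- The matrix `∂` of partial derivatives, acting on the analytic functions on `U`. -/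
def anD {𝕜 : Type*} [RCLike 𝕜] [NormedAlgebra 𝕜 ℂ] {m n : ℕ}
    (U : TopologicalSpace.Opens (Idx m n → 𝕜)) :
    Matrix (Fin (2 * m)) (Fin (2 * n)) (Module.End 𝕜 (analyticFun U)) :=
  matrixOf fun p => anPartial U p

end

end RectCayley

/-! Put Y = XJXᵀ and P = pf Y. All principal pfaffians are collected into one vector v = `pfOn Y`, S
↦ pf Y_SS, of a fermionic Fock space with creation operators θ_a (`cre`) and annihilation operators
∂_a (`ann`). Pfaffian expansion along row a becomes ∂_a v = (∑_b Y_ab θ_b) v (`ann_pfOn`), and this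
system with v_∅ = 1 determines v (`eq_zero_of_ann_eq`). So v behaves like a Grassmann exponential of
Y, but no division is made and any commutative ring is allowed.

Where P is invertible, let R = JXᵀ, W = -Y⁻¹, T = RW, w = P⁻¹v, φ_a = ∑_c W_ac ∂_c and τ_j = ∑_c
T_jc ∂_c. Then φ_a w = -θ_a w. Since the derivative of P in X_aj is -T_ja P, differentiating f P^s
acts on f as E_aj = d_aj - s T_ja. The derivative of w is φ_a τ_j w (`compD_w`), so second
derivatives of w are again fermionic operators applied to w. Contracting them with J leaves only
W_ab, φ_a φ_b and Q = ∑_c ∂_c φ_c (`sum_symplJ_smul_G`), and Q multiplies the component w_S by -(2m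
- |S|) (`Q_w`).

Consequently ∑_b ∂_a ∂_b (EJEᵀ)_ab w has component at S, for a ∉ S, equal to w_S times -(s + 2k)(s +
2n - 2m + 1 + 2k) when |S| = 2m - 2k - 2 (`sum_ann_ann_symplProd`). This is exactly the induction
step of the theorem (`pfOn_symplProd_E`): expand pf (EJEᵀ)_II along its smallest row a. By induction
the cofactor of b, applied to 1, is a constant times w at the complement of I \ {a, b}, that is at
Iᶜ ∪ {a, b}, the component that ∂_a ∂_b reads at Iᶜ. The factors are applied in their written order,
so operators never have to be interchanged.

All four senses come from this computation in a `SymplFrame`, transported along the additive map f ↦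
f P^s (`SymplFrame.cayley_transport`). The polynomial case passes through ℤ[x] ⊂ ℚ(x) and then base
change from ℤ to R. -/

namespace RectCayley

/-! ### Expansion of the pfaffian along the first row -/

/-- The permutation `0, j + 1, …` of `2N + 2` letters built from a permutation `τ` of the
remaining `2N` letters. -/
def extendPerm {N : ℕ} (j : Fin (2 * N + 1)) (τ : Equiv.Perm (Fin (2 * N))) :
    Equiv.Perm (Fin (2 * (N + 1))) :=
  Equiv.Perm.decomposeFin.symm
    (0, j.cycleRange.symm * Equiv.Perm.decomposeFin.symm (0, τ))

theorem extendPerm_zero {N : ℕ} (j : Fin (2 * N + 1)) (τ : Equiv.Perm (Fin (2 * N))) :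
    extendPerm j τ (0 : Fin (2 * N + 1 + 1)) = (0 : Fin (2 * N + 1 + 1)) := by
  simp only [extendPerm]
  exact Equiv.Perm.decomposeFin_symm_apply_zero _ _

theorem extendPerm_one {N : ℕ} (j : Fin (2 * N + 1)) (τ : Equiv.Perm (Fin (2 * N))) :
    extendPerm j τ (Fin.succ (0 : Fin (2 * N + 1))) = j.succ := by
  simp only [extendPerm]
  refine (Equiv.Perm.decomposeFin_symm_apply_succ _ _ _).trans ?_
  rw [Equiv.swap_self, Equiv.Perm.mul_apply, Equiv.Perm.decomposeFin_symm_apply_zero]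
  simp

theorem extendPerm_succ_succ {N : ℕ} (j : Fin (2 * N + 1)) (τ : Equiv.Perm (Fin (2 * N)))
    (i : Fin (2 * N)) :
    extendPerm j τ (i.succ.succ) = (j.succAbove (τ i)).succ := by
  simp only [extendPerm]
  refine (Equiv.Perm.decomposeFin_symm_apply_succ _ _ _).trans ?_
  rw [Equiv.swap_self, Equiv.Perm.mul_apply, Equiv.Perm.decomposeFin_symm_apply_succ]
  simp

/-- Fixing the letter 0 does not change the sign; moving the partner j + 1 to second position is a
cycle of length j + 1. -/
theorem sign_extendPerm {N : ℕ} (j : Fin (2 * N + 1)) (τ : Equiv.Perm (Fin (2 * N))) :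
    Equiv.Perm.sign (extendPerm j τ) = (-1) ^ (j : ℕ) * Equiv.Perm.sign τ := by
  simp only [extendPerm]
  refine (Equiv.Perm.decomposeFin.symm_sign _ _).trans ?_
  simp [Equiv.Perm.decomposeFin.symm_sign, Fin.sign_cycleRange]

theorem evenPos_zero {N : ℕ} : evenPos (0 : Fin (N + 1)) = (0 : Fin (2 * N + 1 + 1)) := rfl

theorem oddPos_zero {N : ℕ} :
    oddPos (0 : Fin (N + 1)) = Fin.succ (0 : Fin (2 * N + 1)) := rfl

theorem evenPos_succ {N : ℕ} (r : Fin N) : evenPos r.succ = (evenPos r).succ.succ := by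
  apply Fin.ext
  simp [evenPos]
  omega

theorem oddPos_succ {N : ℕ} (r : Fin N) : oddPos r.succ = (oddPos r).succ.succ := by
  apply Fin.ext
  simp [oddPos]
  omega

theorem exists_evenPos_or_oddPos {N : ℕ} (i : Fin (2 * N)) :
    (∃ r, i = evenPos r) ∨ ∃ r, i = oddPos r := by
  rcases Nat.even_or_odd' i.1 with ⟨k, hk | hk⟩
  · exact Or.inl ⟨⟨k, by omega⟩, Fin.ext hk⟩
  · exact Or.inr ⟨⟨k, by omega⟩, Fin.ext hk⟩

theorem mem_matchingPerms {N : ℕ} {σ : Equiv.Perm (Fin (2 * N))} :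
    σ ∈ matchingPerms N ↔ (∀ r : Fin N, σ (evenPos r) < σ (oddPos r)) ∧
      ∀ r r' : Fin N, r < r' → σ (evenPos r) < σ (evenPos r') := by
  simp [matchingPerms]

/-- The least letter cannot stand at an odd position, where it would exceed its partner, nor at a
later even position, where it would exceed the letter at position 0. -/
theorem apply_zero_of_mem_matchingPerms {N : ℕ} {σ : Equiv.Perm (Fin (2 * (N + 1)))}
    (h : σ ∈ matchingPerms (N + 1)) :
    σ (0 : Fin (2 * N + 1 + 1)) = (0 : Fin (2 * N + 1 + 1)) := by
  rw [mem_matchingPerms] at h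
  obtain ⟨i, hi⟩ := σ.surjective (0 : Fin (2 * N + 1 + 1))
  rcases exists_evenPos_or_oddPos i with ⟨r, rfl⟩ | ⟨r, rfl⟩
  · rcases eq_or_ne r 0 with rfl | hr
    · exact hi
    · have := h.2 0 r (Fin.pos_iff_ne_zero.2 hr)
      rw [hi] at this
      exact absurd this (Fin.not_lt_zero _)
  · have := h.1 r
    rw [hi] at this
    exact absurd this (Fin.not_lt_zero _)

theorem extendPerm_mem_iff {N : ℕ} (j : Fin (2 * N + 1)) (τ : Equiv.Perm (Fin (2 * N))) :
    extendPerm j τ ∈ matchingPerms (N + 1) ↔ τ ∈ matchingPerms N := by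
  have key : ∀ a b : Fin (2 * N), extendPerm j τ a.succ.succ < extendPerm j τ b.succ.succ ↔
      τ a < τ b := by
    intro a b
    rw [extendPerm_succ_succ, extendPerm_succ_succ]
    exact Fin.succ_lt_succ_iff.trans j.succAbove_lt_succAbove_iff
  rw [mem_matchingPerms, mem_matchingPerms]
  constructor
  · rintro ⟨h1, h2⟩
    refine ⟨fun r => ?_, fun r r' hr => ?_⟩
    · have := h1 r.succ
      rwa [evenPos_succ, oddPos_succ, key] at this
    · have := h2 r.succ r'.succ (Fin.succ_lt_succ_iff.2 hr)
      rwa [evenPos_succ, evenPos_succ, key] at this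
  · rintro ⟨h1, h2⟩
    refine ⟨fun r => ?_, fun r r' hr => ?_⟩
    · refine Fin.cases ?_ (fun r => ?_) r
      · rw [evenPos_zero, oddPos_zero, extendPerm_zero, extendPerm_one]
        exact Fin.succ_pos _
      · rw [evenPos_succ, oddPos_succ, key]
        exact h1 r
    · revert hr
      refine Fin.cases ?_ (fun r' => ?_) r'
      · intro hr
        exact absurd hr (Fin.not_lt_zero _)
      · refine Fin.cases ?_ (fun r => ?_) r
        · intro _
          rw [evenPos_zero, evenPos_succ, extendPerm_zero, extendPerm_succ_succ]
          exact Fin.succ_pos _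
        · intro hr
          rw [evenPos_succ, evenPos_succ, key]
          exact h2 r r' (Fin.succ_lt_succ_iff.1 hr)

theorem exists_eq_extendPerm {N : ℕ} {σ : Equiv.Perm (Fin (2 * (N + 1)))}
    (h : σ (0 : Fin (2 * N + 1 + 1)) = (0 : Fin (2 * N + 1 + 1))) :
    ∃ j τ, σ = extendPerm j τ := by
  obtain ⟨⟨p, ρ⟩, hρ⟩ := (Equiv.Perm.decomposeFin (n := 2 * N + 1)).symm.surjective σ
  have hp : p = 0 := by
    rw [← hρ] at h
    exact (Equiv.Perm.decomposeFin_symm_apply_zero _ _).symm.trans h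
  subst hp
  obtain ⟨⟨q, τ⟩, hτ⟩ :=
    (Equiv.Perm.decomposeFin (n := 2 * N)).symm.surjective ((ρ 0).cycleRange * ρ)
  have hq : q = 0 := by
    have := congrArg (fun f : Equiv.Perm (Fin (2 * N + 1)) => f 0) hτ
    simpa using this
  subst hq
  refine ⟨ρ 0, τ, ?_⟩
  rw [extendPerm, hτ, ← hρ]
  congr 2
  ext i
  simp

theorem extendPerm_injective {N : ℕ} {j j' : Fin (2 * N + 1)} {τ τ' : Equiv.Perm (Fin (2 * N))}
    (h : extendPerm j τ = extendPerm j' τ') : j = j' ∧ τ = τ' := by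
  have hj : j = j' := by
    have := congrArg (fun f : Equiv.Perm (Fin (2 * (N + 1))) =>
      f (Fin.succ (0 : Fin (2 * N + 1)))) h
    simp only [extendPerm_one] at this
    exact Fin.succ_injective _ this
  subst hj
  refine ⟨rfl, Equiv.ext fun i => ?_⟩
  have := congrArg (fun f : Equiv.Perm (Fin (2 * (N + 1))) => f i.succ.succ) h
  simp only [extendPerm_succ_succ] at this
  exact Fin.succAbove_right_injective (Fin.succ_injective _ this)

/-- Expansion of the pfaffian along the first row. -/
theorem pf_succ {A : Type*} [Ring A] {N : ℕ}
    (M : Matrix (Fin (2 * (N + 1))) (Fin (2 * (N + 1))) A) :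
    pf M = ∑ j : Fin (2 * N + 1), (-1 : A) ^ (j : ℕ) *
      (M (0 : Fin (2 * N + 1 + 1)) j.succ *
        pf (N := N) (M.submatrix (fun i => (j.succAbove i).succ)
          (fun i => (j.succAbove i).succ))) := by
  simp only [pf, Finset.mul_sum]
  rw [Finset.sum_sigma']
  symm
  refine Finset.sum_bij (fun x _ => extendPerm x.1 x.2) ?_ ?_ ?_ ?_
  · rintro ⟨j, τ⟩ h
    simp only [Finset.mem_sigma, Finset.mem_univ, true_and] at h
    exact (extendPerm_mem_iff j τ).2 h
  · rintro ⟨j, τ⟩ _ ⟨j', τ'⟩ _ h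
    obtain ⟨rfl, rfl⟩ := extendPerm_injective h
    rfl
  · intro σ hσ
    obtain ⟨j, τ, rfl⟩ := exists_eq_extendPerm (apply_zero_of_mem_matchingPerms hσ)
    exact ⟨⟨j, τ⟩, by simpa using (extendPerm_mem_iff j τ).1 hσ, rfl⟩
  · rintro ⟨j, τ⟩ _
    simp only [sign_extendPerm, List.ofFn_succ, List.prod_cons, evenPos_zero, oddPos_zero,
      extendPerm_zero, extendPerm_one, evenPos_succ, oddPos_succ, extendPerm_succ_succ,
      Matrix.submatrix_apply]
    push_cast
    rw [mul_assoc, ← mul_assoc (M _ _), ← mul_assoc _ (M _ _),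
      -- The sign of `τ` is an integer, hence central; it is the only factor moved past a matrix
      -- entry.
      (Int.cast_commute _ (M (0 : Fin (2 * N + 1 + 1)) j.succ)).eq]

theorem pf_zero {A : Type*} [Ring A] (M : Matrix (Fin (2 * 0)) (Fin (2 * 0)) A) : pf M = 1 := by
  have h : matchingPerms 0 = {1} := by
    ext σ
    have : σ = 1 := Equiv.ext fun i => absurd i.2 (by simp)
    rw [this]
    simp only [mem_matchingPerms, Finset.mem_singleton, iff_true]
    exact ⟨fun r => r.elim0, fun r => r.elim0⟩
  simp [pf, h]

/-- The pfaffian of the principal submatrix `M_{II}`, taken to be `0` when `|I|` is odd. -/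
def pfOn {A : Type*} [Ring A] {N : ℕ} (M : Matrix (Fin N) (Fin N) A) (I : Finset (Fin N)) : A :=
  if h : I.card = 2 * (I.card / 2) then pf (principal M I h) else 0

theorem pfOn_eq {A : Type*} [Ring A] {N k : ℕ} (M : Matrix (Fin N) (Fin N) A)
    {I : Finset (Fin N)} (h : I.card = 2 * k) : pfOn M I = pf (principal M I h) := by
  obtain rfl : k = I.card / 2 := by omega
  exact dif_pos h

theorem pfOn_of_odd {A : Type*} [Ring A] {N : ℕ} (M : Matrix (Fin N) (Fin N) A)
    {I : Finset (Fin N)} (h : I.card % 2 = 1) : pfOn M I = 0 :=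
  dif_neg (by omega)

theorem pfOn_empty {A : Type*} [Ring A] {N : ℕ} (M : Matrix (Fin N) (Fin N) A) :
    pfOn M ∅ = 1 := by
  rw [pfOn_eq (k := 0) M (by simp), pf_zero]

theorem pfOn_univ {A : Type*} [Ring A] {N : ℕ} (M : Matrix (Fin (2 * N)) (Fin (2 * N)) A) :
    pfOn M Finset.univ = pf M := by
  have h : (Finset.univ : Finset (Fin (2 * N))).card = 2 * N := by simp
  rw [pfOn_eq M h, principal]
  congr 1
  have : (id : Fin (2 * N) → Fin (2 * N)) = Finset.univ.orderEmbOfFin h :=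
    Finset.orderEmbOfFin_unique h (fun _ => Finset.mem_univ _) strictMono_id
  rw [← this, Matrix.submatrix_id_id]

/-- The number of elements of `S` below `a`. -/
def below {N : ℕ} (S : Finset (Fin N)) (a : Fin N) : ℕ := (S.filter (· < a)).card

theorem below_orderEmbOfFin {N k : ℕ} {T : Finset (Fin N)} (h : T.card = k) (j : Fin k) :
    below T (T.orderEmbOfFin h j) = j := by
  have : T.filter (· < T.orderEmbOfFin h j) =
      (Finset.Iio j).map (T.orderEmbOfFin h).toEmbedding := by
    ext c
    simp only [Finset.mem_filter, Finset.mem_map, Finset.mem_Iio, RelEmbedding.coe_toEmbedding]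
    constructor
    · rintro ⟨hc, hlt⟩
      rw [← Finset.mem_coe, ← Finset.range_orderEmbOfFin T h] at hc
      obtain ⟨i, rfl⟩ := hc
      exact ⟨i, (T.orderEmbOfFin h).lt_iff_lt.1 hlt, rfl⟩
    · rintro ⟨i, hi, rfl⟩
      exact ⟨Finset.orderEmbOfFin_mem _ _ _, (T.orderEmbOfFin h).lt_iff_lt.2 hi⟩
  rw [below, this, Finset.card_map, Fin.card_Iio]

/-- Expansion of a principal pfaffian along its first row. -/
theorem pfOn_insert {A : Type*} [Ring A] {N : ℕ} (M : Matrix (Fin N) (Fin N) A) {a : Fin N}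
    {T : Finset (Fin N)} (ha : ∀ c ∈ T, a < c) :
    pfOn M (insert a T) =
      ∑ b ∈ T, (-1 : A) ^ below T b * (M a b * pfOn M (T.erase b)) := by
  have haT : a ∉ T := fun h => lt_irrefl _ (ha a h)
  rcases Nat.even_or_odd' T.card with ⟨N', hT | hT⟩
  -- With |T| even, both `insert a T` and every `T.erase b` have odd size, so both sides vanish by
  -- the convention for odd sets.
  · rw [pfOn_of_odd _ (by rw [Finset.card_insert_of_notMem haT]; omega), Finset.sum_eq_zero]
    intro b hb
    rw [pfOn_of_odd M (I := T.erase b), mul_zero, mul_zero]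
    have := Finset.card_erase_add_one hb
    omega
  · have h : (insert a T).card = 2 * (N' + 1) := by
      rw [Finset.card_insert_of_notMem haT]
      omega
    have hcons : (Fin.cons a (T.orderEmbOfFin hT) : Fin (2 * N' + 1 + 1) → Fin N) =
        (insert a T).orderEmbOfFin h := by
      refine Finset.orderEmbOfFin_unique h (fun i => ?_) ?_
      · refine Fin.cases ?_ (fun i => ?_) i
        · simp
        · simp
      · refine Fin.strictMono_iff_lt_succ.2 fun i => ?_
        refine Fin.cases ?_ (fun i => ?_) i
        · exact ha _ (Finset.orderEmbOfFin_mem _ _ _)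
        · rw [← Fin.succ_castSucc, Fin.cons_succ, Fin.cons_succ]
          exact (T.orderEmbOfFin hT).lt_iff_lt.2 (Fin.castSucc_lt_succ)
    have h0 : (insert a T).orderEmbOfFin h (0 : Fin (2 * N' + 1 + 1)) = a := by
      rw [← hcons]
      rfl
    have h1 : ∀ j : Fin (2 * N' + 1),
        (insert a T).orderEmbOfFin h j.succ = T.orderEmbOfFin hT j := by
      intro j
      rw [← hcons]
      rfl
    rw [pfOn_eq M h, pf_succ]
    refine Finset.sum_bij (fun j _ => T.orderEmbOfFin hT j)
      (fun j _ => Finset.orderEmbOfFin_mem _ _ _)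
      (fun j _ j' _ e => (T.orderEmbOfFin hT).injective e) (fun b hb => ?_) (fun j _ => ?_)
    · rw [← Finset.mem_coe, ← Finset.range_orderEmbOfFin T hT] at hb
      obtain ⟨i, rfl⟩ := hb
      exact ⟨i, Finset.mem_univ _, rfl⟩
    · have hc : (T.erase (T.orderEmbOfFin hT j)).card = 2 * N' := by
        have := Finset.card_erase_add_one (Finset.orderEmbOfFin_mem T hT j)
        omega
      have he : (fun i => T.orderEmbOfFin hT (j.succAbove i)) =
          (T.erase (T.orderEmbOfFin hT j)).orderEmbOfFin hc := by
        refine Finset.orderEmbOfFin_unique hc (fun i => ?_) ?_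
        · refine Finset.mem_erase.2 ⟨fun e => ?_, Finset.orderEmbOfFin_mem _ _ _⟩
          exact Fin.succAbove_ne j i ((T.orderEmbOfFin hT).injective e)
        · exact (T.orderEmbOfFin hT).strictMono.comp (Fin.strictMono_succAbove j)
      rw [below_orderEmbOfFin, pfOn_eq M hc]
      simp only [principal, Matrix.submatrix_apply, Matrix.submatrix_submatrix, h0, h1]
      congr 4
      · rw [← he]
        funext i
        exact h1 _
      · rw [← he]
        funext i
        exact h1 _

/-! ### Fermionic Fock space and the vector of principal pfaffians -/

section Fock

variable {N : ℕ} {B : Type*} [CommRing B]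

/-- The sign `(-1)^{#{c ∈ S : c < a}}`. -/
def sg (B : Type*) [CommRing B] {N : ℕ} (S : Finset (Fin N)) (a : Fin N) : B := (-1) ^ below S a

theorem sg_mul_self (S : Finset (Fin N)) (a : Fin N) : sg B S a * sg B S a = 1 := by
  rw [sg, ← mul_pow]
  simp

theorem sg_insert {S : Finset (Fin N)} {b : Fin N} (h : b ∉ S) (a : Fin N) :
    sg B (insert b S) a = if b < a then -sg B S a else sg B S a := by
  unfold sg below
  rw [Finset.filter_insert]
  split_ifs with hb
  · rw [Finset.card_insert_of_notMem (by simp [h]), pow_succ]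
    ring
  · rfl

theorem sg_erase {S : Finset (Fin N)} {b : Fin N} (h : b ∈ S) (a : Fin N) :
    sg B (S.erase b) a = if b < a then -sg B S a else sg B S a := by
  have := sg_insert (B := B) (Finset.notMem_erase b S) a
  rw [Finset.insert_erase h] at this
  rw [this]
  split_ifs <;> simp

theorem sg_eq_one {S : Finset (Fin N)} {a : Fin N} (h : ∀ c ∈ S, a < c) : sg B S a = 1 := by
  have : S.filter (· < a) = ∅ := Finset.filter_eq_empty_iff.2 fun c hc => (h c hc).le.not_gt
  rw [sg, below, this, Finset.card_empty, pow_zero]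

/-- The annihilation operator `∂_a` of fermionic Fock space. -/
def ann (B : Type*) [CommRing B] {N : ℕ} (a : Fin N) : Module.End B (Finset (Fin N) → B) where
  toFun x S := if a ∈ S then 0 else sg B S a * x (insert a S)
  map_add' x y := by
    funext S
    simp only [Pi.add_apply]
    split_ifs <;> ring
  map_smul' c x := by
    funext S
    simp only [Pi.smul_apply, smul_eq_mul, RingHom.id_apply]
    split_ifs <;> ring

/-- The creation operator `θ_a` of fermionic Fock space. -/
def cre (B : Type*) [CommRing B] {N : ℕ} (a : Fin N) : Module.End B (Finset (Fin N) → B) where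
  toFun x S := if a ∈ S then sg B S a * x (S.erase a) else 0
  map_add' x y := by
    funext S
    simp only [Pi.add_apply]
    split_ifs <;> ring
  map_smul' c x := by
    funext S
    simp only [Pi.smul_apply, smul_eq_mul, RingHom.id_apply]
    split_ifs <;> ring

theorem ann_apply (a : Fin N) (x : Finset (Fin N) → B) (S : Finset (Fin N)) :
    ann B a x S = if a ∈ S then 0 else sg B S a * x (insert a S) := rfl

theorem cre_apply (a : Fin N) (x : Finset (Fin N) → B) (S : Finset (Fin N)) :
    cre B a x S = if a ∈ S then sg B S a * x (S.erase a) else 0 := rfl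

theorem ann_mul_self (a : Fin N) : ann B a * ann B a = 0 := by
  refine LinearMap.ext fun x => funext fun S => ?_
  simp [ann_apply]

theorem cre_mul_self (a : Fin N) : cre B a * cre B a = 0 := by
  refine LinearMap.ext fun x => funext fun S => ?_
  simp [cre_apply]

theorem ann_mul_ann (a b : Fin N) : ann B a * ann B b = -(ann B b * ann B a) := by
  rcases eq_or_ne a b with rfl | hab
  · simp [ann_mul_self]
  refine LinearMap.ext fun x => funext fun S => ?_
  simp only [Module.End.mul_apply, LinearMap.neg_apply, Pi.neg_apply, ann_apply,
    Finset.mem_insert, hab, hab.symm, false_or]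
  by_cases ha : a ∈ S <;> by_cases hb : b ∈ S <;> simp only [ha, hb, if_true, if_false, mul_zero,
    neg_zero]
  rw [sg_insert ha, sg_insert hb, Finset.insert_comm]
  rcases lt_or_gt_of_ne hab with h | h
  · rw [if_pos h, if_neg h.not_gt]
    ring
  · rw [if_pos h, if_neg h.not_gt]
    ring

theorem cre_mul_cre (a b : Fin N) : cre B a * cre B b = -(cre B b * cre B a) := by
  rcases eq_or_ne a b with rfl | hab
  · simp [cre_mul_self]
  refine LinearMap.ext fun x => funext fun S => ?_
  simp only [Module.End.mul_apply, LinearMap.neg_apply, Pi.neg_apply, cre_apply,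
    Finset.mem_erase, ne_eq, hab, hab.symm, not_false_iff, true_and]
  by_cases ha : a ∈ S <;> by_cases hb : b ∈ S <;> simp only [ha, hb, if_true, if_false, mul_zero,
    neg_zero]
  rw [sg_erase ha, sg_erase hb, Finset.erase_right_comm]
  rcases lt_or_gt_of_ne hab with h | h
  · rw [if_pos h, if_neg h.not_gt]
    ring
  · rw [if_pos h, if_neg h.not_gt]
    ring

theorem ann_cre_apply_self (a : Fin N) (x : Finset (Fin N) → B) (S : Finset (Fin N)) :
    ann B a (cre B a x) S = if a ∈ S then 0 else x S := by
  rw [ann_apply, cre_apply]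
  split_ifs with h h'
  · rfl
  · rw [Finset.erase_insert h, sg_insert h, if_neg (lt_irrefl a), ← mul_assoc, sg_mul_self,
      one_mul]
  · exact absurd (Finset.mem_insert_self a S) h'

/-- The canonical anticommutation relation. -/
theorem ann_mul_cre (a b : Fin N) :
    ann B a * cre B b = (if a = b then 1 else 0) - cre B b * ann B a := by
  rcases eq_or_ne a b with rfl | hab
  · rw [if_pos rfl]
    refine LinearMap.ext fun x => funext fun S => ?_
    simp only [Module.End.mul_apply, LinearMap.sub_apply, Pi.sub_apply, Module.End.one_apply]
    rw [ann_cre_apply_self, cre_apply, ann_apply]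
    by_cases h : a ∈ S
    · simp only [h, if_true, Finset.mem_erase, ne_eq, not_true_eq_false, false_and, if_false]
      rw [Finset.insert_erase h, sg_erase h, if_neg (lt_irrefl a), ← mul_assoc, sg_mul_self,
        one_mul, sub_self]
    · simp [h]
  rw [if_neg hab, zero_sub]
  refine LinearMap.ext fun x => funext fun S => ?_
  simp only [Module.End.mul_apply, LinearMap.neg_apply, Pi.neg_apply, cre_apply, ann_apply,
    Finset.mem_erase, Finset.mem_insert, ne_eq, hab, hab.symm, not_false_iff, true_and, false_or]
  by_cases ha : a ∈ S <;> by_cases hb : b ∈ S <;> simp only [ha, hb, if_true, if_false, mul_zero,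
    neg_zero]
  rw [sg_insert ha, sg_erase hb, Finset.erase_insert_of_ne hab]
  rcases lt_or_gt_of_ne hab with h | h
  · rw [if_pos h, if_neg h.not_gt]
    ring
  · rw [if_pos h, if_neg h.not_gt]
    ring

/-- The annihilation operator `∑ c_b ∂_b`. -/
def annL (B : Type*) [CommRing B] {N : ℕ} :
    (Fin N → B) →ₗ[B] Module.End B (Finset (Fin N) → B) :=
  Fintype.linearCombination B (ann B)

/-- The creation operator `∑ c_b θ_b`. -/
def creL (B : Type*) [CommRing B] {N : ℕ} :
    (Fin N → B) →ₗ[B] Module.End B (Finset (Fin N) → B) :=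
  Fintype.linearCombination B (cre B)

theorem annL_eq (c : Fin N → B) : annL B c = ∑ b, c b • ann B b := rfl

theorem creL_eq (c : Fin N → B) : creL B c = ∑ b, c b • cre B b := rfl

theorem ann_mul_annL (a : Fin N) (c : Fin N → B) :
    ann B a * annL B c = -(annL B c * ann B a) := by
  simp only [annL_eq, Finset.mul_sum, Finset.sum_mul, mul_smul_comm, smul_mul_assoc,
    ← Finset.sum_neg_distrib]
  exact Finset.sum_congr rfl fun b _ => by rw [ann_mul_ann, smul_neg]

theorem annL_mul_annL (c d : Fin N → B) : annL B c * annL B d = -(annL B d * annL B c) := by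
  conv_lhs => rw [annL_eq c, Finset.sum_mul]
  conv_rhs => rw [annL_eq c, Finset.mul_sum, ← Finset.sum_neg_distrib]
  exact Finset.sum_congr rfl fun b _ => by
    rw [smul_mul_assoc, ann_mul_annL, mul_smul_comm, smul_neg]

theorem cre_mul_creL (a : Fin N) (c : Fin N → B) :
    cre B a * creL B c = -(creL B c * cre B a) := by
  simp only [creL_eq, Finset.mul_sum, Finset.sum_mul, mul_smul_comm, smul_mul_assoc,
    ← Finset.sum_neg_distrib]
  exact Finset.sum_congr rfl fun b _ => by rw [cre_mul_cre, smul_neg]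

theorem creL_mul_creL (c d : Fin N → B) : creL B c * creL B d = -(creL B d * creL B c) := by
  conv_lhs => rw [creL_eq c, Finset.sum_mul]
  conv_rhs => rw [creL_eq c, Finset.mul_sum, ← Finset.sum_neg_distrib]
  exact Finset.sum_congr rfl fun b _ => by
    rw [smul_mul_assoc, cre_mul_creL, mul_smul_comm, smul_neg]

/-- Anticommutation alone would only give that twice the square vanishes. Building the sum one basis
vector at a time, from θ_a² = 0, avoids dividing by 2. -/
theorem creL_mul_self (c : Fin N → B) : creL B c * creL B c = 0 := by
  rw [creL_eq]
  induction (Finset.univ : Finset (Fin N)) using Finset.induction_on with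
  | empty => simp
  | insert a s ha ih =>
    have h : (∑ b ∈ s, c b • cre B b) * cre B a = -(cre B a * ∑ b ∈ s, c b • cre B b) := by
      simp only [Finset.mul_sum, Finset.sum_mul, mul_smul_comm, smul_mul_assoc,
        ← Finset.sum_neg_distrib]
      exact Finset.sum_congr rfl fun b _ => by rw [cre_mul_cre, smul_neg]
    rw [Finset.sum_insert ha, mul_add, add_mul, add_mul, ih, smul_mul_smul_comm, cre_mul_self,
      mul_smul_comm, h, smul_mul_assoc]
    simp

theorem ann_mul_creL (a : Fin N) (c : Fin N → B) :
    ann B a * creL B c = c a • 1 - creL B c * ann B a := by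
  simp only [creL_eq, Finset.mul_sum, Finset.sum_mul, mul_smul_comm, smul_mul_assoc,
    ann_mul_cre, smul_sub, Finset.sum_sub_distrib]
  simp

theorem annL_mul_cre (a : Fin N) (c : Fin N → B) :
    annL B c * cre B a = c a • 1 - cre B a * annL B c := by
  simp only [annL_eq, Finset.mul_sum, Finset.sum_mul, mul_smul_comm, smul_mul_assoc,
    ann_mul_cre, smul_sub, Finset.sum_sub_distrib]
  simp

theorem creL_apply (c : Fin N → B) (x : Finset (Fin N) → B) (S : Finset (Fin N)) :
    creL B c x S = ∑ b ∈ S, sg B S b * (c b * x (S.erase b)) := by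
  rw [creL_eq, LinearMap.sum_apply, Finset.sum_apply]
  simp only [LinearMap.smul_apply, Pi.smul_apply, cre_apply, smul_eq_mul, mul_ite, mul_zero]
  rw [← Finset.sum_filter, Finset.filter_mem_eq_inter, Finset.univ_inter]
  exact Finset.sum_congr rfl fun b _ => by ring

theorem ann_apply_of_lt {a : Fin N} {S : Finset (Fin N)} (h : ∀ c ∈ S, a < c)
    (x : Finset (Fin N) → B) : ann B a x S = x (insert a S) := by
  rw [ann_apply, if_neg fun ha => lt_irrefl a (h a ha), sg_eq_one h, one_mul]

/-- This is the first-row expansion `pfOn_insert` in Fock space form; it starts the induction for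
arbitrary rows. -/
theorem ann_eq_creL_of_lt (Y : Matrix (Fin N) (Fin N) B) {a : Fin N} {S : Finset (Fin N)}
    (h : ∀ c ∈ S, a < c) : ann B a (pfOn Y) S = creL B (Y.row a) (pfOn Y) S := by
  rw [ann_apply_of_lt h, pfOn_insert Y h, creL_apply]
  rfl

/-- Expansion of principal pfaffians along an arbitrary row. -/
theorem ann_pfOn {Y : Matrix (Fin N) (Fin N) B} (hY : ∀ a b, Y a b = -Y b a)
    (hY0 : ∀ a, Y a a = 0) (a : Fin N) : ann B a (pfOn Y) = creL B (Y.row a) (pfOn Y) := by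
  have hcre : ∀ (c : Fin N → B) (x y : Finset (Fin N) → B) (S : Finset (Fin N)),
      (∀ b ∈ S, x (S.erase b) = y (S.erase b)) → creL B c x S = creL B c y S := by
    intro c x y S h
    rw [creL_apply, creL_apply]
    exact Finset.sum_congr rfl fun b hb => by rw [h b hb]
  suffices H : ∀ (n : ℕ) (S : Finset (Fin N)), S.card = n → ∀ a,
      ann B a (pfOn Y) S = creL B (Y.row a) (pfOn Y) S from funext fun S => H _ S rfl a
  intro n
  induction n using Nat.strong_induction_on with
  | _ n ih =>
  rintro S rfl a
  rcases S.eq_empty_or_nonempty with rfl | hS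
  · exact ann_eq_creL_of_lt Y (by simp)
  set m := S.min' hS with hm
  have hmS : m ∈ S := S.min'_mem hS
  have hlt : ∀ c ∈ S.erase m, m < c := fun c hc =>
    lt_of_le_of_ne (S.min'_le c (Finset.mem_of_mem_erase hc)) (Finset.ne_of_mem_erase hc).symm
  have hlt' : ∀ b, ∀ c ∈ (S.erase m).erase b, m < c := fun b c hc =>
    hlt c (Finset.mem_of_mem_erase hc)
  -- Reading a component at S as a component of ∂_m x at S \ {m} lets the commutation relations do
  -- the sign bookkeeping.
  have happ : ∀ x : Finset (Fin N) → B, x S = ann B m x (S.erase m) := fun x => by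
    rw [ann_apply_of_lt hlt, Finset.insert_erase hmS]
  have key : ∀ c, creL B c (ann B m (pfOn Y)) (S.erase m) =
      creL B c (creL B (Y.row m) (pfOn Y)) (S.erase m) := fun c =>
    hcre _ _ _ _ fun b _ => ann_eq_creL_of_lt Y (hlt' b)
  have hcomm : ∀ (b c : Fin N) (x : Finset (Fin N) → B),
      ann B b (creL B (Y.row c) x) = Y c b • x - creL B (Y.row c) (ann B b x) := fun b c x =>
    LinearMap.congr_fun (ann_mul_creL b (Y.row c)) x
  rcases lt_trichotomy a m with h | h | h
  · exact ann_eq_creL_of_lt Y fun c hc => h.trans_le (S.min'_le c hc)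
  -- For a = m the left side is 0. The right side becomes Y_mm v minus the square of ∑ Y_mb θ_b
  -- applied to v, and both terms vanish.
  · rw [h, ann_apply, if_pos hmS, happ (creL B (Y.row m) (pfOn Y)), hcomm, Pi.sub_apply,
      key, ← Module.End.mul_apply,
      creL_mul_self, hY0]
    simp
  -- For a > m, use ∂_m ∂_a = -∂_a ∂_m. The expansion along row m holds since m is minimal; the
  -- expansion along row a is needed only on S with two elements removed, where the induction
  -- hypothesis applies.
  · have h1 : ann B a (ann B m (pfOn Y)) (S.erase m) =
        ann B a (creL B (Y.row m) (pfOn Y)) (S.erase m) := by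
      rw [ann_apply, ann_apply a]
      congr 2
      refine ann_eq_creL_of_lt Y fun c hc => ?_
      rcases Finset.mem_insert.1 hc with rfl | hc
      · exact h
      · exact hlt c hc
    have h2 : creL B (Y.row m) (ann B a (pfOn Y)) (S.erase m) =
        creL B (Y.row m) (creL B (Y.row a) (pfOn Y)) (S.erase m) := by
      refine hcre _ _ _ _ fun b hb => ih _ ?_ _ rfl a
      rw [Finset.card_erase_of_mem hb, Finset.card_erase_of_mem hmS]
      have := hS.card_pos
      omega
    have h3 := LinearMap.congr_fun (ann_mul_ann (B := B) m a) (pfOn Y)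
    have h4 := LinearMap.congr_fun (creL_mul_creL (Y.row m) (Y.row a)) (pfOn Y)
    simp only [Module.End.mul_apply, LinearMap.neg_apply] at h3 h4
    rw [happ (ann B a (pfOn Y)), h3, Pi.neg_apply, h1, hcomm, Pi.sub_apply, h2,
      happ (creL B (Y.row a) (pfOn Y)), hcomm,
      Pi.sub_apply, key, h4, hY a m]
    simp
    ring

/-- A vector with `∂_a x = (∑ Y_{ab} θ_b) x` for all `a` is determined by its vacuum component. -/
theorem eq_zero_of_ann_eq {Y : Matrix (Fin N) (Fin N) B} {x : Finset (Fin N) → B}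
    (h : ∀ a, ann B a x = creL B (Y.row a) x) (h0 : x ∅ = 0) : x = 0 := by
  suffices H : ∀ (n : ℕ) (S : Finset (Fin N)), S.card = n → x S = 0 from
    funext fun S => H _ S rfl
  intro n
  induction n using Nat.strong_induction_on with
  | _ n ih =>
  rintro S rfl
  rcases S.eq_empty_or_nonempty with rfl | hS
  · exact h0
  have hmS := S.min'_mem hS
  have hlt : ∀ c ∈ S.erase (S.min' hS), S.min' hS < c := fun c hc =>
    lt_of_le_of_ne (S.min'_le c (Finset.mem_of_mem_erase hc)) (Finset.ne_of_mem_erase hc).symm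
  have h1 := ann_apply_of_lt hlt x
  rw [Finset.insert_erase hmS, h, creL_apply] at h1
  rw [← h1]
  refine Finset.sum_eq_zero fun b hb => ?_
  rw [ih _ _ _ rfl, mul_zero, mul_zero]
  rw [Finset.card_erase_of_mem hb, Finset.card_erase_of_mem hmS]
  have := hS.card_pos
  omega

variable {R₀ : Type*} [CommRing R₀] [Algebra R₀ B]

/-- A derivation applied componentwise. -/
def compD (δ : Derivation R₀ B B) (x : Finset (Fin N) → B) : Finset (Fin N) → B := fun S => δ (x S)

theorem map_sg (δ : Derivation R₀ B B) (S : Finset (Fin N)) (a : Fin N) : δ (sg B S a) = 0 := by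
  have h : sg B S a = (((-1) ^ below S a : ℤ) : B) := by simp [sg]
  rw [h, Derivation.map_intCast]

theorem compD_ann (δ : Derivation R₀ B B) (a : Fin N) (x : Finset (Fin N) → B) :
    compD δ (ann B a x) = ann B a (compD δ x) := by
  funext S
  simp only [compD, ann_apply]
  split_ifs
  · simp
  · simp [map_sg]

theorem compD_cre (δ : Derivation R₀ B B) (a : Fin N) (x : Finset (Fin N) → B) :
    compD δ (cre B a x) = cre B a (compD δ x) := by
  funext S
  simp only [compD, cre_apply]
  split_ifs
  · simp [map_sg]
  · simp

theorem compD_smul (δ : Derivation R₀ B B) (f : B) (x : Finset (Fin N) → B) :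
    compD δ (f • x) = δ f • x + f • compD δ x := by
  funext S
  simp [compD]
  ring

theorem compD_sum (δ : Derivation R₀ B B) {ι : Type*} (s : Finset ι)
    (x : ι → Finset (Fin N) → B) : compD δ (∑ i ∈ s, x i) = ∑ i ∈ s, compD δ (x i) := by
  funext S
  simp [compD]

theorem compD_annL (δ : Derivation R₀ B B) (c : Fin N → B) (x : Finset (Fin N) → B) :
    compD δ (annL B c x) = annL B (fun b => δ (c b)) x + annL B c (compD δ x) := by
  simp only [annL_eq, LinearMap.sum_apply, LinearMap.smul_apply, compD_sum, compD_smul,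
    Finset.sum_add_distrib, compD_ann]

theorem compD_creL (δ : Derivation R₀ B B) (c : Fin N → B) (x : Finset (Fin N) → B) :
    compD δ (creL B c x) = creL B (fun b => δ (c b)) x + creL B c (compD δ x) := by
  simp only [creL_eq, LinearMap.sum_apply, LinearMap.smul_apply, compD_sum, compD_smul,
    Finset.sum_add_distrib, compD_cre]

theorem creL_single (a : Fin N) : creL B (Pi.single a 1) = cre B a := by
  rw [creL, Fintype.linearCombination_apply_single, one_smul]

/-- The derivative of principal pfaffians under a derivation changing only row and column `a`. -/
theorem compD_pfOn {Y : Matrix (Fin N) (Fin N) B} (hY : ∀ a b, Y a b = -Y b a)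
    (hY0 : ∀ a, Y a a = 0) (δ : Derivation R₀ B B) (a : Fin N) (ρ : Fin N → B)
    (hδ : ∀ c e, δ (Y c e) = (if a = c then ρ e else 0) - (if a = e then ρ c else 0)) :
    compD δ (pfOn Y) = cre B a (creL B ρ (pfOn Y)) := by
  rw [← sub_eq_zero]
  -- The difference of the two sides satisfies the homogeneous system characterizing v and has
  -- vacuum component 0, so it vanishes by uniqueness.
  refine eq_zero_of_ann_eq (Y := Y) (fun m => ?_) ?_
  · have hrow : (fun b => δ (Y.row m b)) =
        (if a = m then (1 : B) else 0) • ρ - ρ m • Pi.single a 1 := by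
      funext b
      rw [Matrix.row_apply, hδ]
      simp only [Pi.sub_apply, Pi.smul_apply, smul_eq_mul, Pi.single_apply, ite_mul, one_mul,
        zero_mul, mul_ite, mul_one, mul_zero, eq_comm (a := b)]
    have h1 := LinearMap.congr_fun (ann_mul_cre (B := B) m a) (creL B ρ (pfOn Y))
    have h2 := LinearMap.congr_fun (ann_mul_creL m ρ) (pfOn Y)
    have h3 := LinearMap.congr_fun (creL_mul_creL ρ (Y.row m)) (pfOn Y)
    have h4 := LinearMap.congr_fun (cre_mul_creL a (Y.row m)) (creL B ρ (pfOn Y))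
    simp only [Module.End.mul_apply, LinearMap.neg_apply, LinearMap.sub_apply,
      LinearMap.smul_apply, Module.End.one_apply] at h1 h2 h3 h4
    rw [map_sub, map_sub, ← compD_ann, ann_pfOn hY hY0, compD_creL, hrow, map_sub, map_smul,
      map_smul, creL_single, h1, h2, map_sub, map_smul, ann_pfOn hY hY0, h3, map_neg, h4]
    by_cases h : a = m
    · subst h
      simp
      abel
    · simp [h, Ne.symm h]
      abel
  · simp [compD, cre_apply, pfOn_empty]

end Fock

/-! ### The symplectic form and the matrix XJXᵀ -/

theorem symplJ_eq_intCast {A : Type*} [Ring A] (n : ℕ) (i j : Fin (2 * n)) :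
    symplJ A n i j = ((symplJ ℤ n i j : ℤ) : A) := by
  simp only [symplJ, Matrix.of_apply]
  split_ifs <;> simp

theorem symplJ_transpose {A : Type*} [Ring A] (n : ℕ) : (symplJ A n).transpose = -symplJ A n := by
  ext i j
  simp only [symplJ, Matrix.of_apply, Matrix.transpose_apply, Matrix.neg_apply]
  split_ifs <;> first | omega | simp

theorem symplJ_self {A : Type*} [Ring A] (n : ℕ) (i : Fin (2 * n)) : symplJ A n i i = 0 := by
  simp only [symplJ, Matrix.of_apply]
  split_ifs <;> first | omega | simp

theorem symplJ_mul_self {A : Type*} [Ring A] (n : ℕ) : symplJ A n * symplJ A n = -1 := by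
  ext i j
  rw [Matrix.mul_apply, Matrix.neg_apply, Matrix.one_apply]
  rcases Nat.even_or_odd' i.1 with ⟨k, hk | hk⟩
  · have hk' : 2 * k + 1 < 2 * n := by omega
    rw [Finset.sum_eq_single (⟨2 * k + 1, hk'⟩ : Fin (2 * n))]
    · simp only [symplJ, Matrix.of_apply, Fin.ext_iff]
      split_ifs <;> first | omega | simp
    · intro l _ hl
      rw [ne_eq, Fin.ext_iff] at hl
      simp only [symplJ, Matrix.of_apply]
      split_ifs <;> first | omega | (simp at hl ⊢; try omega)
    · simp
  · have hk' : 2 * k < 2 * n := by omega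
    rw [Finset.sum_eq_single (⟨2 * k, hk'⟩ : Fin (2 * n))]
    · simp only [symplJ, Matrix.of_apply, Fin.ext_iff]
      split_ifs <;> first | omega | simp
    · intro l _ hl
      rw [ne_eq, Fin.ext_iff] at hl
      simp only [symplJ, Matrix.of_apply]
      split_ifs <;> first | omega | (simp at hl ⊢; try omega)
    · simp

/-- The entries of J are integers, hence central, so this form also serves for matrices of operators
and is visibly preserved by ring homomorphisms. -/
theorem symplProd_apply {A : Type*} [Ring A] {m n : ℕ}
    (Y : Matrix (Fin (2 * m)) (Fin (2 * n)) A) (a b : Fin (2 * m)) :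
    symplProd Y a b = ∑ j, ∑ l, symplJ ℤ n j l • (Y a j * Y b l) := by
  rw [symplProd, Matrix.mul_apply, Finset.sum_comm]
  refine Finset.sum_congr rfl fun l _ => ?_
  rw [Matrix.mul_apply, Finset.sum_mul]
  refine Finset.sum_congr rfl fun j _ => ?_
  rw [Matrix.transpose_apply, symplJ_eq_intCast, zsmul_eq_mul, ← mul_assoc,
    (Int.cast_commute _ (Y a j)).eq]

section Commutative

variable {B : Type*} [CommRing B] {m n : ℕ}

theorem symplProd_transpose (X : Matrix (Fin (2 * m)) (Fin (2 * n)) B) :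
    (symplProd X).transpose = -symplProd X := by
  rw [symplProd, Matrix.transpose_mul, Matrix.transpose_mul, Matrix.transpose_transpose,
    symplJ_transpose, Matrix.neg_mul, Matrix.mul_neg, Matrix.mul_assoc]

theorem symplProd_antisymm (X : Matrix (Fin (2 * m)) (Fin (2 * n)) B) (a b : Fin (2 * m)) :
    symplProd X a b = -symplProd X b a :=
  congrFun (congrFun (symplProd_transpose X) b) a

/-- Antisymmetry does not suffice when 2 is a zero divisor. Instead the terms (j, l) and (l, j)
cancel, and the fixed points of the swap carry J_jj = 0. -/
theorem symplProd_self (X : Matrix (Fin (2 * m)) (Fin (2 * n)) B) (a : Fin (2 * m)) :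
    symplProd X a a = 0 := by
  rw [symplProd_apply, ← Finset.sum_product']
  refine Finset.sum_involution (fun p _ => p.swap) ?_ ?_ (by simp) (by simp)
  · rintro ⟨j, l⟩ _
    have h : symplJ ℤ n l j = -symplJ ℤ n j l := congrFun (congrFun (symplJ_transpose n) j) l
    simp only [Prod.fst_swap, Prod.snd_swap, h, mul_comm (X a l), neg_smul, add_neg_cancel]
  · rintro ⟨j, l⟩ _ h heq
    obtain rfl : l = j := congrArg Prod.fst heq
    simp [symplJ_self] at h

end Commutative

/-! ### Inverse of an antisymmetric matrix by pfaffian cofactors -/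

/-- The negative of the inverse of an antisymmetric matrix `Y`, given by pfaffian cofactors;
`pinv` is the inverse of the pfaffian of `Y`. -/
def negInv {B : Type*} [CommRing B] {N : ℕ} (Y : Matrix (Fin N) (Fin N) B) (pinv : B) :
    Matrix (Fin N) (Fin N) B :=
  Matrix.of fun c b => pinv * cre B c (cre B b (pfOn Y)) Finset.univ

section NegInv

variable {B : Type*} [CommRing B] {N : ℕ} {Y : Matrix (Fin N) (Fin N) B} {pinv : B}

theorem negInv_antisymm (a b : Fin N) : negInv Y pinv a b = -negInv Y pinv b a := by
  have h := congrFun (LinearMap.congr_fun (cre_mul_cre (B := B) a b) (pfOn Y)) Finset.univ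
  simp only [Module.End.mul_apply, LinearMap.neg_apply, Pi.neg_apply] at h
  simp [negInv, h]

theorem sum_mul_negInv (c : Fin N) (r : Fin N → B) :
    ∑ b, r b * negInv Y pinv c b = pinv * cre B c (creL B r (pfOn Y)) Finset.univ := by
  simp only [creL_eq, LinearMap.sum_apply, map_sum, Finset.sum_apply, Finset.mul_sum,
    LinearMap.smul_apply, map_smul, Pi.smul_apply, smul_eq_mul, negInv, Matrix.of_apply]
  exact Finset.sum_congr rfl fun b _ => by ring

/-- In the full component, ∂_a applied to any vector is 0, so the relation ∂_a θ_c + θ_c ∂_a = δ_ac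
reduces to θ_c ∂_a v = δ_ac v. Replacing ∂_a v by (∑ Y_ab θ_b) v turns this into the cofactor
identity. -/
theorem mul_negInv (hY : ∀ a b, Y a b = -Y b a) (hY0 : ∀ a, Y a a = 0)
    (hp : pinv * pfOn Y Finset.univ = 1) : Y * negInv Y pinv = -1 := by
  ext a c
  have h1 : ∑ b, Y a b * negInv Y pinv b c = -∑ b, Y.row a b * negInv Y pinv c b := by
    rw [← Finset.sum_neg_distrib]
    exact Finset.sum_congr rfl fun b _ => by rw [negInv_antisymm, Matrix.row_apply, mul_neg]
  have h2 := congrFun (LinearMap.congr_fun (ann_mul_cre (B := B) a c) (pfOn Y)) Finset.univ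
  simp only [Module.End.mul_apply, LinearMap.sub_apply, Pi.sub_apply] at h2
  rw [ann_apply, if_pos (Finset.mem_univ _), eq_comm, sub_eq_zero] at h2
  rw [Matrix.mul_apply, h1, sum_mul_negInv, ← ann_pfOn hY hY0, ← h2, Matrix.neg_apply,
    Matrix.one_apply]
  split_ifs
  · simp [hp]
  · simp

theorem negInv_mul (hY : ∀ a b, Y a b = -Y b a) (hY0 : ∀ a, Y a a = 0)
    (hp : pinv * pfOn Y Finset.univ = 1) : negInv Y pinv * Y = -1 := by
  have h := mul_negInv hY hY0 hp
  have h' : Y * -negInv Y pinv = 1 := by rw [Matrix.mul_neg, h, neg_neg]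
  rw [mul_eq_one_comm, Matrix.neg_mul] at h'
  rw [← h', neg_neg]

/-- Multiplying the system ∂_b v = (∑_c Y_bc θ_c) v by the negative inverse of Y solves it for θ_a
v: creation operators acting on v can be traded for annihilation operators. -/
theorem annL_negInv_pfOn (hY : ∀ a b, Y a b = -Y b a) (hY0 : ∀ a, Y a a = 0)
    (hp : pinv * pfOn Y Finset.univ = 1) (a : Fin N) :
    annL B ((negInv Y pinv).row a) (pfOn Y) = -cre B a (pfOn Y) := by
  have h : ∑ b, (negInv Y pinv) a b • Y.row b = -Pi.single a 1 := by
    funext c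
    have := congrFun (congrFun (negInv_mul hY hY0 hp) a) c
    rw [Matrix.mul_apply, Matrix.neg_apply, Matrix.one_apply] at this
    simp only [Finset.sum_apply, Pi.smul_apply, Matrix.row_apply, smul_eq_mul, this, Pi.neg_apply,
      Pi.single_apply, eq_comm (a := c)]
  rw [annL_eq]
  simp only [LinearMap.sum_apply, LinearMap.smul_apply, ann_pfOn hY hY0, Matrix.row_apply]
  rw [← creL_single, ← LinearMap.neg_apply, ← map_neg, ← h, map_sum, LinearMap.sum_apply]
  simp only [map_smul, LinearMap.smul_apply]

end NegInv

/-! ### Frames: the matrices R, W, T and their derivatives -/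

theorem map_matrix_mul {R₀ B : Type*} [CommRing R₀] [CommRing B] [Algebra R₀ B]
    (δ : Derivation R₀ B B) {ι κ l : Type*} [Fintype κ] (M : Matrix ι κ B) (M' : Matrix κ l B) :
    (M * M').map δ = M.map δ * M' + M * M'.map δ := by
  ext i k
  simp only [Matrix.map_apply, Matrix.mul_apply, Matrix.add_apply, map_sum, Derivation.leibniz,
    smul_eq_mul, ← Finset.sum_add_distrib]
  exact Finset.sum_congr rfl fun j _ => by ring

/-- A `2m × 2n` matrix `X` with entries in an algebra `B` with partial derivatives
`d a j = ∂/∂X_{aj}`, such that `pf (X J Xᵀ)` is invertible, and a constant `s`. -/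
structure SymplFrame (R₀ B : Type*) [CommRing R₀] [CommRing B] [Algebra R₀ B] (m n : ℕ) where
  X : Matrix (Fin (2 * m)) (Fin (2 * n)) B
  d : Fin (2 * m) → Fin (2 * n) → Derivation R₀ B B
  d_X : ∀ a j b l, d a j (X b l) = if a = b ∧ j = l then 1 else 0
  s : R₀
  pinv : B
  pinv_mul : pinv * pf (symplProd X) = 1

namespace SymplFrame

variable {R₀ B : Type*} [CommRing R₀] [CommRing B] [Algebra R₀ B] {m n : ℕ}
  (F : SymplFrame R₀ B m n)

/-- The matrix `J Xᵀ`. -/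
def R : Matrix (Fin (2 * n)) (Fin (2 * m)) B := symplJ B n * F.X.transpose

/-- The matrix `-(X J Xᵀ)⁻¹`. -/
def W : Matrix (Fin (2 * m)) (Fin (2 * m)) B := negInv (symplProd F.X) F.pinv

/-- The matrix `-J Xᵀ (X J Xᵀ)⁻¹`. -/
def T : Matrix (Fin (2 * n)) (Fin (2 * m)) B := F.R * F.W

theorem pinv_mul_univ : F.pinv * pfOn (symplProd F.X) Finset.univ = 1 := by
  rw [pfOn_univ, F.pinv_mul]

theorem W_antisymm (a b : Fin (2 * m)) : F.W a b = -F.W b a := negInv_antisymm a b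

theorem W_transpose : F.W.transpose = -F.W := by
  ext a b
  exact F.W_antisymm b a

theorem mul_W : symplProd F.X * F.W = -1 :=
  mul_negInv (symplProd_antisymm _) (symplProd_self _) F.pinv_mul_univ

theorem W_mul : F.W * symplProd F.X = -1 :=
  negInv_mul (symplProd_antisymm _) (symplProd_self _) F.pinv_mul_univ

theorem R_transpose : F.R.transpose = -(F.X * symplJ B n) := by
  rw [R, Matrix.transpose_mul, Matrix.transpose_transpose, symplJ_transpose, Matrix.mul_neg]

theorem R_transpose_mul_R : F.R.transpose * symplJ B n * F.R = symplProd F.X := by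
  rw [R_transpose, R, symplProd, Matrix.neg_mul, Matrix.mul_assoc F.X, symplJ_mul_self,
    Matrix.mul_neg, Matrix.mul_one, neg_neg, Matrix.mul_assoc]

theorem T_transpose_mul_T : F.T.transpose * symplJ B n * F.T = F.W := by
  have h : F.T.transpose * symplJ B n * F.T =
      F.W.transpose * ((F.R.transpose * symplJ B n * F.R) * F.W) := by
    simp only [T, Matrix.transpose_mul, Matrix.mul_assoc]
  rw [h, R_transpose_mul_R, mul_W, W_transpose]
  simp

theorem T_transpose_mul_R : F.T.transpose * symplJ B n * F.R = 1 := by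
  have h : F.T.transpose * symplJ B n * F.R =
      F.W.transpose * (F.R.transpose * symplJ B n * F.R) := by
    simp only [T, Matrix.transpose_mul, Matrix.mul_assoc]
  rw [h, R_transpose_mul_R, W_transpose, Matrix.neg_mul, W_mul, neg_neg]

theorem map_symplJ (δ : Derivation R₀ B B) : (symplJ B n).map δ = 0 := by
  ext i j
  rw [Matrix.map_apply, symplJ_eq_intCast, Derivation.map_intCast, Matrix.zero_apply]

theorem d_R (a : Fin (2 * m)) (j l : Fin (2 * n)) (e : Fin (2 * m)) :
    F.d a j (F.R l e) = if a = e then symplJ B n l j else 0 := by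
  change (F.R.map (F.d a j)) l e = _
  rw [R, map_matrix_mul, map_symplJ, Matrix.zero_mul, zero_add, Matrix.mul_apply]
  simp only [Matrix.map_apply, Matrix.transpose_apply, F.d_X]
  by_cases h : a = e <;> simp [h]

theorem d_symplProd (a : Fin (2 * m)) (j : Fin (2 * n)) (c e : Fin (2 * m)) :
    F.d a j (symplProd F.X c e) =
      (if a = c then F.R j e else 0) - (if a = e then F.R j c else 0) := by
  change ((symplProd F.X).map (F.d a j)) c e = _
  have h1 : F.X.map (F.d a j) * F.R = Matrix.of fun c e => if a = c then F.R j e else 0 := by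
    ext c e
    simp only [Matrix.mul_apply, Matrix.map_apply, F.d_X, Matrix.of_apply]
    by_cases h : a = c <;> simp [h]
  have h2 : F.X * F.R.map (F.d a j) = -Matrix.of fun c e => if a = e then F.R j c else 0 := by
    have h3 : ∀ c, (F.X * symplJ B n) c j = -F.R j c := fun c => by
      have := congrFun (congrFun F.R_transpose c) j
      rw [Matrix.transpose_apply, Matrix.neg_apply] at this
      rw [this, neg_neg]
    ext c e
    rw [Matrix.neg_apply, Matrix.of_apply, Matrix.mul_apply]
    simp only [Matrix.map_apply, d_R]
    by_cases h : a = e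
    · simp only [h, if_true, ← h3 c, ← Matrix.mul_apply]
    · simp [h]
  have h4 : symplProd F.X = F.X * F.R := by rw [symplProd, R, Matrix.mul_assoc]
  rw [h4, map_matrix_mul, h1, h2]
  simp [sub_eq_add_neg]

/-- Differentiating WY = -1 gives dW = W (dY) W. Here dY = e_a R_jᵀ - R_j e_aᵀ, with R_j the row j
of R, and multiplication by W carries R_j to -T_j from the left and to T_j from the right. -/
theorem d_W (a : Fin (2 * m)) (j : Fin (2 * n)) (b e : Fin (2 * m)) :
    F.d a j (F.W b e) = F.W b a * F.T j e + F.T j b * F.W a e := by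
  have h1 : F.W.map (F.d a j) = F.W * (symplProd F.X).map (F.d a j) * F.W := by
    have h2 := congrArg (fun M : Matrix (Fin (2 * m)) (Fin (2 * m)) B => M.map (F.d a j) * F.W)
      F.W_mul
    have h3 : (-1 : Matrix (Fin (2 * m)) (Fin (2 * m)) B).map (F.d a j) = 0 := by
      ext i k
      rw [Matrix.map_apply, Matrix.neg_apply, Matrix.one_apply]
      split_ifs <;> simp
    simp only [map_matrix_mul, h3, Matrix.add_mul, Matrix.mul_assoc, F.mul_W, Matrix.zero_mul,
      Matrix.mul_neg, Matrix.mul_one] at h2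
    rw [Matrix.mul_assoc, ← sub_eq_zero, ← neg_eq_zero, neg_sub, ← h2]
    abel
  have h4 : (symplProd F.X).map (F.d a j) =
      Matrix.vecMulVec (Pi.single a 1) (F.R.row j) -
        Matrix.vecMulVec (F.R.row j) (Pi.single a 1) := by
    ext c e
    rw [Matrix.map_apply, d_symplProd]
    simp [Matrix.vecMulVec_apply, Pi.single_apply, eq_comm (a := a)]
  have h5 : Matrix.mulVec F.W (F.R.row j) = -F.T.row j := by
    funext c
    rw [Matrix.mulVec, dotProduct, Pi.neg_apply, Matrix.row_apply, T, Matrix.mul_apply,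
      ← Finset.sum_neg_distrib]
    exact Finset.sum_congr rfl fun i _ => by rw [F.W_antisymm, Matrix.row_apply]; ring
  have h6 : Matrix.vecMul (F.R.row j) F.W = F.T.row j := by
    funext c
    rw [Matrix.vecMul, dotProduct, Matrix.row_apply, T, Matrix.mul_apply]
    rfl
  change (F.W.map (F.d a j)) b e = _
  rw [h1, h4, Matrix.mul_sub, Matrix.sub_mul, Matrix.mul_vecMulVec, Matrix.mul_vecMulVec,
    Matrix.vecMulVec_mul, Matrix.vecMulVec_mul, h5, h6]
  simp [Matrix.vecMulVec_apply]

/-- The matrix `J + J Xᵀ Tᵀ`. -/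
def K : Matrix (Fin (2 * n)) (Fin (2 * n)) B := symplJ B n + F.R * F.T.transpose

/-- By Leibniz, dT = (dR) W + R (dW). The matrix K collects the coefficients of W_ae: J from the
first summand and RTᵀ from the second. -/
theorem d_T (a : Fin (2 * m)) (j l : Fin (2 * n)) (e : Fin (2 * m)) :
    F.d a j (F.T l e) = F.K l j * F.W a e + F.T l a * F.T j e := by
  have h1 : F.R.map (F.d a j) * F.W = Matrix.of fun l e => symplJ B n l j * F.W a e := by
    ext l e
    simp [Matrix.mul_apply, d_R]
  have h2 : F.R * F.W.map (F.d a j) =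
      Matrix.of fun l e => F.T l a * F.T j e + (F.R * F.T.transpose) l j * F.W a e := by
    ext l e
    simp only [Matrix.mul_apply, Matrix.map_apply, d_W, mul_add, Finset.sum_add_distrib,
      Matrix.of_apply, Matrix.transpose_apply, ← mul_assoc, ← Finset.sum_mul]
    rw [T]
    simp only [Matrix.mul_apply]
  have h3 : F.T.map (F.d a j) = F.R.map (F.d a j) * F.W + F.R * F.W.map (F.d a j) :=
    map_matrix_mul _ _ _
  change (F.T.map (F.d a j)) l e = _
  rw [h3, h1, h2]
  simp only [Matrix.add_apply, Matrix.of_apply, K]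
  ring

/-- The trace of JK is tr J² = -2n plus tr (TᵀJR) = tr 1 = 2m. This is where the dimensions enter
the Cayley factor. -/
theorem sum_symplJ_mul_K : ∑ j, ∑ l, symplJ B n j l * F.K l j = 2 * (m : B) - 2 * (n : B) := by
  have h : ∑ j, ∑ l, symplJ B n j l * F.K l j = (symplJ B n * F.K).trace := by
    simp only [Matrix.trace, Matrix.diag_apply, Matrix.mul_apply]
  have h' : (symplJ B n * (F.R * F.T.transpose)).trace = (1 : Matrix (Fin (2 * m)) _ B).trace := by
    rw [← Matrix.mul_assoc, Matrix.trace_mul_comm, ← Matrix.mul_assoc, T_transpose_mul_R]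
  rw [h, K, Matrix.mul_add, Matrix.trace_add, h', symplJ_mul_self, Matrix.trace_neg]
  simp
  ring

theorem sum_symplJ_mul_T_mul_T (a b : Fin (2 * m)) :
    ∑ j, ∑ l, symplJ B n j l * (F.T j a * F.T l b) = F.W a b := by
  rw [← F.T_transpose_mul_T, Matrix.mul_apply, Finset.sum_comm]
  refine Finset.sum_congr rfl fun l _ => ?_
  rw [Matrix.mul_apply, Finset.sum_mul]
  exact Finset.sum_congr rfl fun j _ => by rw [Matrix.transpose_apply]; ring

end SymplFrame

/-! ### Second derivatives in Fock space and the key identity -/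

theorem end_mul_neg {B ι : Type*} [CommRing B] (x y : Module.End B (ι → B)) :
    x * -y = -(x * y) := LinearMap.ext fun v => map_neg x (y v)

theorem end_neg_mul {B ι : Type*} [CommRing B] (x y : Module.End B (ι → B)) :
    -x * y = -(x * y) := rfl

theorem end_mul_sub {B ι : Type*} [CommRing B] (x y z : Module.End B (ι → B)) :
    x * (y - z) = x * y - x * z := LinearMap.ext fun v => map_sub x (y v) (z v)

/-- Multiplication of the component at `S` by `f |S|`. -/
def gradeMul {B : Type*} [CommRing B] {N : ℕ} (f : ℕ → B) (x : Finset (Fin N) → B) :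
    Finset (Fin N) → B := fun S => f S.card * x S

theorem ann_gradeMul {B : Type*} [CommRing B] {N : ℕ} (f : ℕ → B) (a : Fin N)
    (x : Finset (Fin N) → B) :
    ann B a (gradeMul f x) = gradeMul (fun k => f (k + 1)) (ann B a x) := by
  funext S
  simp only [gradeMul, ann_apply]
  split_ifs with h
  · simp
  · rw [Finset.card_insert_of_notMem h]
    ring

theorem annL_gradeMul {B : Type*} [CommRing B] {N : ℕ} (f : ℕ → B) (c : Fin N → B)
    (x : Finset (Fin N) → B) :
    annL B c (gradeMul f x) = gradeMul (fun k => f (k + 1)) (annL B c x) := by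
  funext S
  simp only [annL_eq, LinearMap.sum_apply, LinearMap.smul_apply, ann_gradeMul, Finset.sum_apply,
    Pi.smul_apply, gradeMul, Finset.mul_sum, smul_eq_mul]
  exact Finset.sum_congr rfl fun b _ => by ring

/-- Each ∂_c θ_c is the projection onto the components S not containing c, so the sum counts the
complement of S. -/
theorem sum_ann_cre {B : Type*} [CommRing B] {N : ℕ} (x : Finset (Fin N) → B) :
    ∑ c, ann B c (cre B c x) = gradeMul (fun k => (N : B) - k) x := by
  funext S
  simp only [Finset.sum_apply, ann_cre_apply_self, gradeMul]
  rw [Finset.sum_ite, Finset.sum_const_zero, zero_add, Finset.sum_const, nsmul_eq_mul]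
  have h : (Finset.univ.filter fun c => c ∉ S) = Sᶜ := by
    ext c
    simp
  have h' : (S.card : B) + (Sᶜ.card : B) = (N : B) := by
    rw [← Nat.cast_add, Finset.card_add_card_compl, Fintype.card_fin]
  rw [h, ← eq_sub_of_add_eq' h']

namespace SymplFrame

variable {R₀ B : Type*} [CommRing R₀] [CommRing B] [Algebra R₀ B] {m n : ℕ}
  (F : SymplFrame R₀ B m n)

/-- The partial derivative `∂/∂X_{aj}` acting on the factor `f` of `f P^s`. -/
def E (a : Fin (2 * m)) (j : Fin (2 * n)) : Module.End R₀ B :=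
  (F.d a j).toLinearMap + LinearMap.mulLeft R₀ (-(algebraMap R₀ B F.s * F.T j a))

theorem E_apply (a : Fin (2 * m)) (j : Fin (2 * n)) (f : B) :
    F.E a j f = F.d a j f - algebraMap R₀ B F.s * F.T j a * f := by
  simp [E, sub_eq_add_neg]

/-- The vector `P⁻¹ (pf (X J Xᵀ)_{SS})_S`. -/
def w : Finset (Fin (2 * m)) → B := F.pinv • pfOn (symplProd F.X)

/-- The operator `∑_c W_{ac} ∂_c`. -/
def φ (a : Fin (2 * m)) : Module.End B (Finset (Fin (2 * m)) → B) := annL B (F.W.row a)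

/-- The operator `∑_c T_{jc} ∂_c`. -/
def τ (j : Fin (2 * n)) : Module.End B (Finset (Fin (2 * m)) → B) := annL B (F.T.row j)

theorem φ_w (a : Fin (2 * m)) : F.φ a F.w = -cre B a F.w := by
  rw [φ, w, map_smul, map_smul, W,
    annL_negInv_pfOn (symplProd_antisymm _) (symplProd_self _) F.pinv_mul_univ, smul_neg]

theorem τ_eq (j : Fin (2 * n)) : F.τ j = ∑ e, F.R j e • F.φ e := by
  simp only [τ, φ, ← map_smul, ← map_sum]
  congr 1
  funext c
  simp [T, Matrix.mul_apply]

/-- The top component of the derivative of v is θ_a (∑_b R_jb θ_b) v, which expresses it by the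
cofactors that define W. So -T_ja is the logarithmic derivative of P, which explains the definition
of `E`. -/
theorem d_pf (a : Fin (2 * m)) (j : Fin (2 * n)) :
    F.d a j (pf (symplProd F.X)) = -(F.T j a * pf (symplProd F.X)) := by
  have h1 := compD_pfOn (symplProd_antisymm F.X) (symplProd_self F.X) (F.d a j) a (F.R.row j)
    (F.d_symplProd a j)
  have h2 : F.pinv * F.d a j (pfOn (symplProd F.X) Finset.univ) = -F.T j a := by
    have h3 : F.d a j (pfOn (symplProd F.X) Finset.univ) =
        compD (F.d a j) (pfOn (symplProd F.X)) Finset.univ := rfl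
    rw [h3, h1, ← sum_mul_negInv, T, Matrix.mul_apply, ← Finset.sum_neg_distrib]
    exact Finset.sum_congr rfl fun b _ => by
      rw [show F.W b a = -F.W a b from F.W_antisymm b a, mul_neg, neg_neg]
      rfl
  rw [pfOn_univ] at h2
  linear_combination pf (symplProd F.X) * h2 - F.d a j (pf (symplProd F.X)) * F.pinv_mul

theorem d_pinv (a : Fin (2 * m)) (j : Fin (2 * n)) : F.d a j F.pinv = F.pinv * F.T j a := by
  have h := congrArg (F.d a j) F.pinv_mul
  rw [Derivation.leibniz, smul_eq_mul, smul_eq_mul, Derivation.map_one_eq_zero, d_pf] at h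
  linear_combination F.pinv * h - (F.d a j F.pinv - F.pinv * F.T j a) * F.pinv_mul

/-- Trading creation for annihilation, the derivative of v contributes -θ_a τ_j w, and that of P⁻¹
contributes T_ja w. Their sum is τ_j θ_a w = -τ_j φ_a w = φ_a τ_j w. -/
theorem compD_w (a : Fin (2 * m)) (j : Fin (2 * n)) :
    compD (F.d a j) F.w = F.φ a (F.τ j F.w) := by
  have h1 := compD_pfOn (symplProd_antisymm F.X) (symplProd_self F.X) (F.d a j) a (F.R.row j)
    (F.d_symplProd a j)
  have h4 := F.d_pinv a j
  have h5 : creL B (F.R.row j) F.w = -F.τ j F.w := by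
    rw [τ_eq, creL_eq, LinearMap.sum_apply, LinearMap.sum_apply,
      ← Finset.sum_neg_distrib]
    exact Finset.sum_congr rfl fun e _ => by
      rw [LinearMap.smul_apply, LinearMap.smul_apply, φ_w, smul_neg, neg_neg, Matrix.row_apply]
  have h6 := LinearMap.congr_fun (annL_mul_cre a (F.T.row j)) F.w
  have h7 := LinearMap.congr_fun (annL_mul_annL (F.W.row a) (F.T.row j)) F.w
  simp only [Module.End.mul_apply, LinearMap.sub_apply, LinearMap.smul_apply, LinearMap.neg_apply,
    Module.End.one_apply] at h6 h7
  have h8 : F.φ a (F.τ j F.w) = F.T j a • F.w - cre B a (F.τ j F.w) := by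
    have h9 := F.φ_w a
    unfold φ τ at *
    rw [h7, h9, map_neg, neg_neg, h6, Matrix.row_apply]
  rw [h8, w, compD_smul, h1, h4, ← map_smul, ← map_smul, ← w, h5]
  rw [map_neg, w, smul_smul, mul_comm (F.T j a), ← sub_eq_add_neg]

/-- The componentwise action of `E`. -/
def compE (a : Fin (2 * m)) (j : Fin (2 * n)) (x : Finset (Fin (2 * m)) → B) :
    Finset (Fin (2 * m)) → B := fun S => F.E a j (x S)

theorem compE_eq (a : Fin (2 * m)) (j : Fin (2 * n)) (x : Finset (Fin (2 * m)) → B) :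
    F.compE a j x = compD (F.d a j) x - (algebraMap R₀ B F.s * F.T j a) • x := by
  funext S
  simp [compE, E_apply, compD]

theorem compE_add (a : Fin (2 * m)) (j : Fin (2 * n)) (x y : Finset (Fin (2 * m)) → B) :
    F.compE a j (x + y) = F.compE a j x + F.compE a j y := by
  funext S
  simp [compE]

theorem compE_smul (a : Fin (2 * m)) (j : Fin (2 * n)) (f : B) (x : Finset (Fin (2 * m)) → B) :
    F.compE a j (f • x) = F.d a j f • x + f • F.compE a j x := by
  rw [compE_eq, compE_eq, compD_smul]
  module

theorem compE_annL (a : Fin (2 * m)) (j : Fin (2 * n)) (c : Fin (2 * m) → B)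
    (x : Finset (Fin (2 * m)) → B) :
    F.compE a j (annL B c x) = annL B (fun b => F.d a j (c b)) x + annL B c (F.compE a j x) := by
  rw [compE_eq, compE_eq, compD_annL, map_sub, map_smul]
  abel

theorem compE_w (a : Fin (2 * m)) (j : Fin (2 * n)) :
    F.compE a j F.w = (-(algebraMap R₀ B F.s * F.T j a)) • F.w + F.φ a (F.τ j F.w) := by
  rw [compE_eq, compD_w]
  module

theorem compE_φ (a : Fin (2 * m)) (j : Fin (2 * n)) (b : Fin (2 * m))
    (x : Finset (Fin (2 * m)) → B) :
    F.compE a j (F.φ b x) = F.W b a • F.τ j x + F.T j b • F.φ a x + F.φ b (F.compE a j x) := by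
  have h : (fun e => F.d a j (F.W.row b e)) = F.W b a • F.T.row j + F.T j b • F.W.row a := by
    funext e
    simp [d_W]
  rw [φ, compE_annL, h, map_add, map_smul, map_smul]
  rfl

theorem compE_τ (a : Fin (2 * m)) (j l : Fin (2 * n)) (x : Finset (Fin (2 * m)) → B) :
    F.compE a j (F.τ l x) = F.K l j • F.φ a x + F.T l a • F.τ j x + F.τ l (F.compE a j x) := by
  have h : (fun e => F.d a j (F.T.row l e)) = F.K l j • F.W.row a + F.T l a • F.T.row j := by
    funext e
    simp [d_T]
  rw [τ, compE_annL, h, map_add, map_smul, map_smul]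
  rfl

/-- The operator `G` such that `E_{aj} E_{bl} w = G w`. -/
def G (a b : Fin (2 * m)) (j l : Fin (2 * n)) : Module.End B (Finset (Fin (2 * m)) → B) :=
  (-(algebraMap R₀ B F.s * (F.K l j * F.W a b + F.T l a * F.T j b))) • 1 +
    (-(algebraMap R₀ B F.s * F.T l b)) •
      ((-(algebraMap R₀ B F.s * F.T j a)) • 1 + F.φ a * F.τ j) +
    (F.W b a • F.τ j + F.T j b • F.φ a) * F.τ l +
    F.φ b * (F.K l j • F.φ a + F.T l a • F.τ j) +
    F.φ b * F.τ l * ((-(algebraMap R₀ B F.s * F.T j a)) • 1 + F.φ a * F.τ j)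

/-- Each derivative falling on W, T or w produces a combination of φ, τ and scalars, so the
differential operators disappear and only an algebraic operator on w remains. -/
theorem compE_compE_w (a b : Fin (2 * m)) (j l : Fin (2 * n)) :
    F.compE a j (F.compE b l F.w) = F.G a b j l F.w := by
  have h : F.d a j (-(algebraMap R₀ B F.s * F.T l b)) =
      -(algebraMap R₀ B F.s * (F.K l j * F.W a b + F.T l a * F.T j b)) := by
    rw [map_neg, Derivation.leibniz, Derivation.map_algebraMap, d_T, smul_zero, add_zero,
      smul_eq_mul]
  rw [compE_w, compE_add, compE_smul, compE_φ, compE_τ, compE_w, h]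
  simp only [G, LinearMap.add_apply, LinearMap.smul_apply, Module.End.mul_apply,
    Module.End.one_apply, map_add, map_smul, smul_add]
  abel

/-- The operator `∑ W_{cd} ∂_c ∂_d`. -/
def Q : Module.End B (Finset (Fin (2 * m)) → B) := ∑ c, ann B c * F.φ c

theorem φ_mul_φ (a b : Fin (2 * m)) : F.φ a * F.φ b = -(F.φ b * F.φ a) := annL_mul_annL _ _

theorem φ_mul_τ (a : Fin (2 * m)) (j : Fin (2 * n)) : F.φ a * F.τ j = -(F.τ j * F.φ a) :=
  annL_mul_annL _ _

theorem τ_mul_τ (j l : Fin (2 * n)) : F.τ j * F.τ l = -(F.τ l * F.τ j) :=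
  annL_mul_annL _ _

theorem ann_mul_φ (a b : Fin (2 * m)) : ann B a * F.φ b = -(F.φ b * ann B a) :=
  ann_mul_annL _ _

theorem sum_symplJ_smul_τ (b : Fin (2 * m)) :
    ∑ j, ∑ l, (symplJ B n j l * F.T j b) • F.τ l = F.φ b := by
  simp only [τ, φ, ← map_smul, ← map_sum]
  congr 1
  funext c
  simp only [Finset.sum_apply, Pi.smul_apply, Matrix.row_apply, smul_eq_mul]
  rw [← F.sum_symplJ_mul_T_mul_T b c]
  simp only [mul_assoc]

theorem sum_symplJ_smul_τ' (b : Fin (2 * m)) :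
    ∑ j, ∑ l, (symplJ B n j l * F.T l b) • F.τ j = -F.φ b := by
  rw [← sum_symplJ_smul_τ, Finset.sum_comm, ← Finset.sum_neg_distrib]
  refine Finset.sum_congr rfl fun l _ => ?_
  rw [← Finset.sum_neg_distrib]
  refine Finset.sum_congr rfl fun j _ => ?_
  have h : symplJ B n l j = -symplJ B n j l := congrFun (congrFun (symplJ_transpose n) j) l
  rw [h]
  module

/-- Both factors τ have coefficients from T, and TᵀJT = W. -/
theorem sum_symplJ_smul_τ_mul_τ : ∑ j, ∑ l, symplJ B n j l • (F.τ j * F.τ l) = F.Q := by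
  have h : ∀ j l, symplJ B n j l • (F.τ j * F.τ l) =
      ∑ c, ann B c * ((symplJ B n j l * F.T j c) • F.τ l) := by
    intro j l
    conv_lhs => rw [τ, annL_eq, Finset.sum_mul, Finset.smul_sum]
    refine Finset.sum_congr rfl fun c _ => ?_
    rw [smul_mul_assoc, smul_smul, mul_smul_comm, Matrix.row_apply]
  simp only [h, Q, ← sum_symplJ_smul_τ, Finset.mul_sum]
  rw [Finset.sum_comm (s := (Finset.univ : Finset (Fin (2 * m))))]
  exact Finset.sum_congr rfl fun j _ => Finset.sum_comm

/-- The contraction of `G` with the symplectic form. -/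
theorem sum_symplJ_smul_G (a b : Fin (2 * m)) :
    ∑ j, ∑ l, symplJ B n j l • F.G a b j l =
      F.W a b • ((algebraMap R₀ B F.s * (algebraMap R₀ B F.s + 1 - (2 * m - 2 * n))) • 1 - F.Q) +
        F.φ a * F.φ b * ((2 * algebraMap R₀ B F.s + 2 - (2 * m - 2 * n)) • 1 - F.Q) := by
  set s := algebraMap R₀ B F.s
  have hτ : ∀ j l, F.τ l * (F.φ a * F.τ j) = F.φ a * (F.τ j * F.τ l) := by
    intro j l
    rw [← mul_assoc, ← neg_eq_iff_eq_neg.2 (F.φ_mul_τ a l), neg_mul, mul_assoc, F.τ_mul_τ l j,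
      end_mul_neg, neg_neg]
  -- The ten summands are sorted by how they depend on j and l. The contractions with J are then
  -- known: K gives 2m - 2n, two entries of T give W, one T with one τ gives ±φ, and two τ give Q.
  have h : ∀ j l, symplJ B n j l • F.G a b j l =
      (-s * F.W a b) • ((symplJ B n j l * F.K l j) • 1) +
      (-s) • ((symplJ B n j l * (F.T j b * F.T l a)) • 1) +
      (s * s) • ((symplJ B n j l * (F.T j a * F.T l b)) • 1) +
      (-s) • (F.φ a * ((symplJ B n j l * F.T l b) • F.τ j)) +
      F.W b a • (symplJ B n j l • (F.τ j * F.τ l)) +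
      F.φ a * ((symplJ B n j l * F.T j b) • F.τ l) +
      (symplJ B n j l * F.K l j) • (F.φ b * F.φ a) +
      F.φ b * ((symplJ B n j l * F.T l a) • F.τ j) +
      (-s) • (F.φ b * ((symplJ B n j l * F.T j a) • F.τ l)) +
      F.φ b * F.φ a * (symplJ B n j l • (F.τ j * F.τ l)) := by
    intro j l
    rw [G]
    simp only [mul_add, add_mul, smul_add, mul_smul_comm, smul_mul_assoc, mul_one, mul_assoc, hτ,
      smul_smul]
    module
  have hK : ∀ x : Module.End B (Finset (Fin (2 * m)) → B),
      ∑ j, ∑ l, (symplJ B n j l * F.K l j) • x = (2 * m - 2 * n : B) • x := fun x => by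
    simp only [← Finset.sum_smul, sum_symplJ_mul_K]
  have hT : ∀ c d, ∑ j, ∑ l, (symplJ B n j l * (F.T j c * F.T l d)) •
      (1 : Module.End B (Finset (Fin (2 * m)) → B)) = F.W c d • 1 := fun c d => by
    simp only [← Finset.sum_smul, sum_symplJ_mul_T_mul_T]
  simp only [h, Finset.sum_add_distrib, ← Finset.smul_sum, ← Finset.mul_sum, hK, hT,
    sum_symplJ_smul_τ, sum_symplJ_smul_τ', sum_symplJ_smul_τ_mul_τ]
  rw [F.W_antisymm b a, F.φ_mul_φ b a]
  simp only [end_mul_sub, end_mul_neg, end_neg_mul, mul_smul_comm, mul_one, F.φ_mul_φ b a]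
  module

/-- Summing W_ab ∂_b over b gives φ_a. In the other term ∂_b anticommutes past φ_a, leaving -φ_a ∑
∂_b φ_b = -φ_a Q. Both terms thus have the common left factor ∂_a φ_a. -/
theorem sum_ann_mul_ann_mul (a : Fin (2 * m)) (x y : Module.End B (Finset (Fin (2 * m)) → B)) :
    ∑ b, ann B a * (ann B b * (F.W a b • x + F.φ a * F.φ b * y)) =
      ann B a * F.φ a * (x - F.Q * y) := by
  have h : ∀ b, ann B a * (ann B b * (F.W a b • x + F.φ a * F.φ b * y)) =
      ann B a * ((F.W.row a b • ann B b) * x) - ann B a * F.φ a * (ann B b * F.φ b * y) := by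
    intro b
    have h1 : ann B b * (F.φ a * F.φ b * y) = -(F.φ a * (ann B b * F.φ b * y)) := by
      rw [mul_assoc, ← mul_assoc, ann_mul_φ, end_neg_mul]
      simp only [mul_assoc]
    rw [mul_add, h1, mul_add, end_mul_neg, ← sub_eq_add_neg, mul_smul_comm, smul_mul_assoc,
      Matrix.row_apply, mul_assoc (ann B a) (F.φ a)]
  simp only [h, Finset.sum_sub_distrib, ← Finset.mul_sum, ← Finset.sum_mul]
  rw [end_mul_sub, Q, ← mul_assoc (ann B a)]
  rfl

theorem Q_gradeMul (f : ℕ → B) (x : Finset (Fin (2 * m)) → B) :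
    F.Q (gradeMul f x) = gradeMul (fun k => f (k + 2)) (F.Q x) := by
  funext S
  simp only [Q, LinearMap.sum_apply, Module.End.mul_apply, φ, annL_gradeMul, ann_gradeMul,
    Finset.sum_apply, gradeMul, Finset.mul_sum]

/-- Since φ_c w = -θ_c w, Q acts on w as -∑ ∂_c θ_c, which counts the complement. -/
theorem Q_w : F.Q F.w = -gradeMul (fun k => (2 * m : B) - k) F.w := by
  have h := sum_ann_cre F.w
  push_cast at h
  simp only [Q, LinearMap.sum_apply, Module.End.mul_apply, φ_w, map_neg]
  rw [Finset.sum_neg_distrib, h]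

theorem compE_symplProd (a b : Fin (2 * m)) :
    (fun S => symplProd (Matrix.of F.E) a b (F.w S)) =
      ∑ j, ∑ l, symplJ B n j l • F.compE a j (F.compE b l F.w) := by
  funext S
  rw [symplProd_apply]
  simp only [LinearMap.sum_apply, Finset.sum_apply, Pi.smul_apply, LinearMap.smul_apply]
  refine Finset.sum_congr rfl fun j _ => Finset.sum_congr rfl fun l _ => ?_
  rw [symplJ_eq_intCast (A := B), smul_eq_mul, zsmul_eq_mul]
  rfl

/-- The key identity: the contraction of the second order operators with `∂_a ∂_b` acts on `w`
by a scalar on each component. -/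
theorem sum_ann_ann_symplProd (a : Fin (2 * m)) {S : Finset (Fin (2 * m))} (ha : a ∉ S) :
    ∑ b, ann B a (ann B b (fun S => symplProd (Matrix.of F.E) a b (F.w S))) S =
      -(((algebraMap R₀ B F.s + (2 * m - (S.card + 2))) *
        (algebraMap R₀ B F.s + 2 * n - 2 * m + 1 + (2 * m - (S.card + 2)))) * F.w S) := by
  set s := algebraMap R₀ B F.s with hs
  have h1 : ∀ b, (fun S => symplProd (Matrix.of F.E) a b (F.w S)) =
      (F.W a b • ((s * (s + 1 - (2 * m - 2 * n))) • 1 - F.Q) +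
        F.φ a * F.φ b * ((2 * s + 2 - (2 * m - 2 * n)) • 1 - F.Q)) F.w := by
    intro b
    rw [compE_symplProd, ← sum_symplJ_smul_G]
    simp only [compE_compE_w, LinearMap.sum_apply, LinearMap.smul_apply]
  have h2 := LinearMap.congr_fun (F.sum_ann_mul_ann_mul a
    ((s * (s + 1 - (2 * m - 2 * n))) • 1 - F.Q)
    ((2 * s + 2 - (2 * m - 2 * n)) • 1 - F.Q)) F.w
  -- With u = 2m - |S|, Q gives -u and Q² gives u(u - 2), because Q lowers the degree by 2. The
  -- resulting quadratic in s and u factors as (s + u)(s + u + 2n - 2m + 1).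
  have h3 : (((s * (s + 1 - (2 * m - 2 * n))) • 1 - F.Q) -
      F.Q * ((2 * s + 2 - (2 * m - 2 * n)) • 1 - F.Q)) F.w =
      gradeMul (fun k => (s + (2 * m - k)) * (s + 2 * n - 2 * m + 1 + (2 * m - k))) F.w := by
    simp only [LinearMap.sub_apply, Module.End.mul_apply, LinearMap.smul_apply,
      Module.End.one_apply, map_sub, map_smul, Q_w, map_neg, Q_gradeMul]
    funext S
    simp only [Pi.sub_apply, Pi.smul_apply, Pi.neg_apply, gradeMul, smul_eq_mul]
    push_cast
    ring
  have h4 := congrFun h2 S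
  simp only [Module.End.mul_apply (ann B a * F.φ a)] at h4
  -- Moving the scalar out past ∂_a φ_a replaces |S| by |S| + 2; then ∂_a φ_a w = -∂_a θ_a w is -w_S
  -- for a ∉ S.
  rw [h3, Module.End.mul_apply, φ, annL_gradeMul, ann_gradeMul, ← φ, φ_w, map_neg] at h4
  simp only [gradeMul, Pi.neg_apply, ann_cre_apply_self, if_neg ha, LinearMap.sum_apply,
    Finset.sum_apply, Module.End.mul_apply] at h4
  simp only [h1]
  rw [h4]
  push_cast
  ring

end SymplFrame

/-! ### The sign ε(I) and the induction on |I| -/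

theorem below_add_below_compl {N : ℕ} (I : Finset (Fin N)) (b : Fin N) :
    below I b + below Iᶜ b = b := by
  have h := Finset.card_union_of_disjoint (s := I.filter (· < b)) (t := Iᶜ.filter (· < b))
    (Finset.disjoint_filter_filter disjoint_compl_right)
  rw [← Finset.filter_union, Finset.union_compl] at h
  have h' : Finset.univ.filter (· < b) = Finset.Iio b := by
    ext c
    simp
  rw [below, below, ← h, h', Fin.card_Iio]

theorem below_insert_of_lt {N : ℕ} {S : Finset (Fin N)} {a b : Fin N} (h : a ∉ S) (hab : a < b) :
    below (insert a S) b = below S b + 1 := by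
  rw [below, Finset.filter_insert, if_pos hab, Finset.card_insert_of_notMem (by simp [h]), below]

theorem below_eq_zero {N : ℕ} {S : Finset (Fin N)} {a : Fin N} (h : ∀ c ∈ S, a ≤ c) :
    below S a = 0 := by
  rw [below, Finset.card_eq_zero]
  exact Finset.filter_eq_empty_iff.2 fun c hc => (h c hc).not_gt

/-- The recursion of the sign `ε(I)` on removing the smallest element `a` of `I` and another
element `b`. -/
theorem eps_insert {N k : ℕ} {a b : Fin N} {T : Finset (Fin N)} (ha : ∀ c ∈ T, a < c)
    (hb : b ∈ T) (hT : T.card = 2 * k + 1) :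
    (-1) ^ below T b * eps (T.erase b) =
      -(eps (insert a T) * ((-1) ^ below (insert a T)ᶜ a *
        (-1) ^ below (insert a (insert a T)ᶜ) b)) := by
  have haT : a ∉ T := fun h => lt_irrefl _ (ha a h)
  have hab := ha b hb
  have h1 : below (insert a T)ᶜ a = a := by
    have := below_add_below_compl (insert a T) a
    rwa [below_eq_zero, zero_add] at this
    intro c hc
    rcases Finset.mem_insert.1 hc with rfl | hc
    · exact le_rfl
    · exact (ha c hc).le
  have h2 := below_add_below_compl (insert a T) b
  rw [below_insert_of_lt haT hab] at h2
  have h3 : below (insert a (insert a T)ᶜ) b = below (insert a T)ᶜ b + 1 :=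
    below_insert_of_lt (by simp) hab
  have h4 : (T.erase b).card = 2 * k := by
    rw [Finset.card_erase_of_mem hb, hT]
    omega
  have h5 : (insert a T).card = 2 * k + 2 := by rw [Finset.card_insert_of_notMem haT, hT]
  -- The removed positions contribute a + b up to parity. The ranks of a and b in I and in its
  -- complement account for this, and the odd jump 4k + 1 of the triangular exponent in `h7` enters
  -- the overall sign.
  have h6 : ∑ i ∈ insert a T, (i.1 + 1) = (a + 1) + ((b + 1) + ∑ i ∈ T.erase b, (i.1 + 1)) := by
    rw [Finset.sum_insert haT, ← Finset.add_sum_erase T _ hb]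
  have h7 : (2 * k + 2) * (2 * k + 2 - 1) / 2 = 2 * k * (2 * k - 1) / 2 + (4 * k + 1) := by
    rcases k with _ | k
    · rfl
    · have e1 : 2 * (k + 1) * (2 * (k + 1) - 1) = 2 * ((k + 1) * (2 * k + 1)) := by
        rw [show 2 * (k + 1) - 1 = 2 * k + 1 by omega]
        ring
      have e2 : (2 * (k + 1) + 2) * (2 * (k + 1) + 2 - 1) = 2 * ((k + 2) * (2 * k + 3)) := by
        rw [show 2 * (k + 1) + 2 - 1 = 2 * k + 3 by omega]
        ring
      rw [e1, e2, Nat.mul_div_cancel_left _ two_pos, Nat.mul_div_cancel_left _ two_pos]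
      ring
  rw [eps, eps, h4, h5, h6, h7, h1, h3, ← h2]
  have sq : ∀ i : ℕ, ((-1 : ℤ) ^ i) * (-1) ^ i = 1 := fun i => by rw [← mul_pow]; simp
  have h8 : (-1 : ℤ) ^ (4 * k + 1) = -1 := by
    rw [pow_succ, show 4 * k = 2 * (2 * k) by ring, pow_mul]
    simp
  simp only [pow_add, h8, pow_one]
  linear_combination (-((-1) ^ below T b * (-1) ^ (2 * k * (2 * k - 1) / 2) *
      (-1) ^ (∑ i ∈ T.erase b, (i.1 + 1))) * ((-1) ^ below (insert a T)ᶜ b *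
      (-1) ^ below (insert a T)ᶜ b)) * sq a -
    ((-1) ^ below T b * (-1) ^ (2 * k * (2 * k - 1) / 2) *
      (-1) ^ (∑ i ∈ T.erase b, (i.1 + 1))) * sq (below (insert a T)ᶜ b)

theorem map_cayleyFactor {A A' : Type*} [CommRing A] [CommRing A'] (f : A →+* A') (s : A)
    (m n k : ℕ) : f (cayleyFactor s m n k) = cayleyFactor (f s) m n k := by
  simp [cayleyFactor, map_prod, map_ofNat f 2]

namespace SymplFrame

variable {R₀ B : Type*} [CommRing R₀] [CommRing B] [Algebra R₀ B] {m n : ℕ}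
  (F : SymplFrame R₀ B m n)

/-- The Cayley identity for `P^s`, all operators acting on the factors of `P^s`. -/
theorem pfOn_symplProd_E (k : ℕ) (I : Finset (Fin (2 * m))) (hI : I.card = 2 * k) :
    pfOn (symplProd (Matrix.of F.E)) I 1 =
      cayleyFactor (algebraMap R₀ B F.s) m n k * ((eps I : ℤ) : B) * F.w Iᶜ := by
  induction k generalizing I with
  | zero =>
    obtain rfl := Finset.card_eq_zero.1 hI
    have h : F.w Finset.univ = 1 := F.pinv_mul_univ
    simp [pfOn_empty, cayleyFactor, eps, h]
  | succ k ih =>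
    have hne : I.Nonempty := Finset.card_pos.1 (by omega)
    obtain ⟨a, T, ha, rfl⟩ : ∃ a T, (∀ c ∈ T, a < c) ∧ insert a T = I :=
      ⟨I.min' hne, I.erase (I.min' hne), fun c hc =>
        lt_of_le_of_ne (I.min'_le c (Finset.mem_of_mem_erase hc))
          (Finset.ne_of_mem_erase hc).symm, Finset.insert_erase (I.min'_mem hne)⟩
    have haT : a ∉ T := fun h => lt_irrefl _ (ha a h)
    have hT : T.card = 2 * k + 1 := by
      rw [Finset.card_insert_of_notMem haT] at hI
      omega
    have hm : k + 1 ≤ m := by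
      have := Finset.card_le_univ (insert a T)
      rw [Fintype.card_fin] at this
      omega
    have haS : a ∉ (insert a T)ᶜ := by simp
    have hS : (((insert a T)ᶜ.card : ℕ) : B) = 2 * m - 2 * (k + 1) := by
      rw [Finset.card_compl, hI, Fintype.card_fin, Nat.cast_sub (by omega)]
      push_cast
      ring
    have key := F.sum_ann_ann_symplProd a haS
    have hsum : ∑ b, ann B a (ann B b (fun S => symplProd (Matrix.of F.E) a b (F.w S)))
        (insert a T)ᶜ = ∑ b ∈ T, sg B (insert a T)ᶜ a * (sg B (insert a (insert a T)ᶜ) b *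
          symplProd (Matrix.of F.E) a b (F.w (T.erase b)ᶜ)) := by
      -- For b = a or b in the complement of `insert a T`, the component read by ∂_a ∂_b is 0; only
      -- b ∈ T survives.
      rw [← Finset.sum_subset (Finset.subset_univ T)]
      · refine Finset.sum_congr rfl fun b hb => ?_
        have hab := (ha b hb).ne'
        have he : insert b (insert a (insert a T)ᶜ) = (T.erase b)ᶜ := by
          ext c
          simp only [Finset.mem_insert, Finset.mem_compl, Finset.mem_erase]
          by_cases hcb : c = b <;> by_cases hca : c = a <;> simp [hcb, hca, haT]
        rw [ann_apply, if_neg haS, ann_apply, if_neg (by simp [hb, hab]), he]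
      · intro b _ hb
        rw [ann_apply, if_neg haS, ann_apply, if_pos (by
          by_cases hab : b = a <;> simp [hb, hab]), mul_zero]
    have hterm : ∀ b ∈ T, ((-1 : Module.End R₀ B) ^ below T b *
        (symplProd (Matrix.of F.E) a b * pfOn (symplProd (Matrix.of F.E)) (T.erase b))) 1 =
        -(cayleyFactor (algebraMap R₀ B F.s) m n k * ((eps (insert a T) : ℤ) : B)) *
        (sg B (insert a T)ᶜ a * (sg B (insert a (insert a T)ᶜ) b *
          symplProd (Matrix.of F.E) a b (F.w (T.erase b)ᶜ))) := by
      intro b hb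
      have hcard : (T.erase b).card = 2 * k := by
        rw [Finset.card_erase_of_mem hb, hT]
        omega
      have h1 : (-1 : Module.End R₀ B) ^ below T b =
          (((-1) ^ below T b : ℤ) : Module.End R₀ B) := by simp
      have h2 : ∀ (z : ℤ) (f : B), ((z : ℤ) : Module.End R₀ B) f = (z : B) * f := fun z f => by
        rw [Module.End.intCast_apply, zsmul_eq_mul]
      -- The constant from the induction hypothesis comes from R₀, so the R₀-linear operator
      -- (EJEᵀ)_ab passes through it.
      have h3 : cayleyFactor (algebraMap R₀ B F.s) m n k * ((eps (T.erase b) : ℤ) : B) *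
          F.w (T.erase b)ᶜ =
          (cayleyFactor F.s m n k * ((eps (T.erase b) : ℤ) : R₀)) • F.w (T.erase b)ᶜ := by
        rw [Algebra.smul_def, map_mul, map_cayleyFactor, map_intCast]
      have h4 := congrArg (fun z : ℤ => (z : B)) (eps_insert ha hb hT)
      simp only [Int.cast_mul, Int.cast_neg, Int.cast_pow, Int.cast_one] at h4
      rw [Module.End.mul_apply, Module.End.mul_apply, ih _ hcard, h3, map_smul, h1, h2,
        Algebra.smul_def, map_mul, map_cayleyFactor, map_intCast]
      simp only [sg]
      push_cast
      linear_combination (cayleyFactor (algebraMap R₀ B F.s) m n k *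
        symplProd (Matrix.of F.E) a b (F.w (T.erase b)ᶜ)) * h4
    rw [pfOn_insert _ ha, LinearMap.sum_apply, Finset.sum_congr rfl hterm, ← Finset.mul_sum,
      ← hsum, key, hS, cayleyFactor, cayleyFactor, Finset.prod_range_succ]
    ring

end SymplFrame

/-! ### Ring homomorphisms and intertwining maps -/

theorem map_pf {A A' : Type*} [Ring A] [Ring A'] (f : A →+* A') {N : ℕ}
    (M : Matrix (Fin (2 * N)) (Fin (2 * N)) A) : f (pf M) = pf (M.map f) := by
  simp only [pf, map_sum, map_mul, map_intCast, map_list_prod, List.map_ofFn]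
  rfl

theorem map_pfOn {A A' : Type*} [Ring A] [Ring A'] (f : A →+* A') {N : ℕ}
    (M : Matrix (Fin N) (Fin N) A) (I : Finset (Fin N)) : f (pfOn M I) = pfOn (M.map f) I := by
  unfold pfOn
  split_ifs
  · rw [map_pf]
    rfl
  · exact map_zero f

theorem symplProd_map {A A' : Type*} [Ring A] [Ring A'] (f : A →+* A') {m n : ℕ}
    (Y : Matrix (Fin (2 * m)) (Fin (2 * n)) A) : symplProd (Y.map f) = (symplProd Y).map f := by
  ext a b
  simp [symplProd_apply]

/-- The pairs of operators intertwined by an additive map `t`. -/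
def intertwiners {R R' M M' : Type*} [CommRing R] [CommRing R'] [AddCommGroup M] [AddCommGroup M']
    [Module R M] [Module R' M'] (t : M →+ M') :
    Subring (Module.End R M × Module.End R' M') where
  carrier := {p | ∀ v, t (p.1 v) = p.2 (t v)}
  mul_mem' {p q} hp hq v := by
    simp only [Prod.fst_mul, Prod.snd_mul, Module.End.mul_apply]
    rw [hp, hq]
  one_mem' v := rfl
  add_mem' {p q} hp hq v := by
    simp only [Prod.fst_add, Prod.snd_add, LinearMap.add_apply, map_add]
    rw [hp, hq]
  zero_mem' v := by simp
  neg_mem' {p} hp v := by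
    simp only [Prod.fst_neg, Prod.snd_neg, LinearMap.neg_apply, map_neg]
    rw [hp]

/-- An additive map intertwining two families of operators intertwines the pfaffians. -/
theorem pfOn_symplProd_intertwine {R R' M M' : Type*} [CommRing R] [CommRing R'] [AddCommGroup M]
    [AddCommGroup M'] [Module R M] [Module R' M'] (t : M →+ M') {m n : ℕ}
    (D : Matrix (Fin (2 * m)) (Fin (2 * n)) (Module.End R M))
    (D' : Matrix (Fin (2 * m)) (Fin (2 * n)) (Module.End R' M'))
    (h : ∀ a j v, t (D a j v) = D' a j (t v)) (I : Finset (Fin (2 * m))) (v : M) :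
    t (pfOn (symplProd D) I v) = pfOn (symplProd D') I (t v) := by
  -- Intertwined pairs form a ring, so the pfaffian can be computed once over this ring; its two
  -- projections are the two pfaffians.
  let S := intertwiners (R := R) (R' := R') t
  let Z : Matrix (Fin (2 * m)) (Fin (2 * n)) S := Matrix.of fun a j => ⟨(D a j, D' a j), h a j⟩
  have h1 : pfOn (symplProd D) I =
      ((pfOn (symplProd Z) I : S) : Module.End R M × Module.End R' M').1 := by
    have := map_pfOn ((RingHom.fst _ _).comp S.subtype) (symplProd Z) I
    rw [← symplProd_map] at this
    exact this.symm
  have h2 : pfOn (symplProd D') I =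
      ((pfOn (symplProd Z) I : S) : Module.End R M × Module.End R' M').2 := by
    have := map_pfOn ((RingHom.snd _ _).comp S.subtype) (symplProd Z) I
    rw [← symplProd_map] at this
    exact this.symm
  rw [h1, h2]
  exact (pfOn (symplProd Z) I).2 v

/-- The exponents m(2m - 1) and m(2m + 1) add up to the even number 4m². -/
theorem eps_univ (m : ℕ) : eps (Finset.univ : Finset (Fin (2 * m))) = 1 := by
  have h1 : (∑ i : Fin (2 * m), (i.1 + 1)) = m * (2 * m + 1) := by
    rw [Fin.sum_univ_eq_sum_range (fun i => i + 1) (2 * m)]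
    induction m with
    | zero => rfl
    | succ m ih =>
      rw [show 2 * (m + 1) = 2 * m + 1 + 1 by ring, Finset.sum_range_succ, Finset.sum_range_succ,
        ih]
      ring
  have h2 : 2 * m * (2 * m - 1) / 2 = m * (2 * m - 1) := by
    rw [mul_assoc, Nat.mul_div_cancel_left _ two_pos]
  have h3 : m * (2 * m - 1) + m * (2 * m + 1) = 2 * (2 * m * m) := by
    rcases m with _ | m
    · rfl
    · rw [show 2 * (m + 1) - 1 = 2 * m + 1 by omega]
      ring
  rw [eps, Finset.card_univ, Fintype.card_fin, h1, h2, ← pow_add, h3, pow_mul]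
  simp

/-- The Cayley identity transported along an additive map `f ↦ f P^s`. -/
theorem SymplFrame.cayley_transport {R₀ B R' M : Type*} [CommRing R₀] [CommRing B] [Algebra R₀ B]
    [CommRing R'] [AddCommGroup M] [Module R' M] {m n : ℕ} (F : SymplFrame R₀ B m n) (t : B →+ M)
    (D : Matrix (Fin (2 * m)) (Fin (2 * n)) (Module.End R' M))
    (h : ∀ a j f, t (F.d a j f - algebraMap R₀ B F.s * F.T j a * f) = D a j (t f)) {k : ℕ}
    {I : Finset (Fin (2 * m))} (hI : I.card = 2 * k) :
    pf (principal (symplProd D) I hI) (t 1) =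
      t (cayleyFactor (algebraMap R₀ B F.s) m n k * F.pinv * ((eps I : ℤ) : B) *
        pf (principal (symplProd F.X) Iᶜ (card_compl_eq hI))) := by
  have h1 := F.pfOn_symplProd_E k I hI
  have h2 := pfOn_symplProd_intertwine t (Matrix.of F.E) D
    (fun a j v => by rw [← h, Matrix.of_apply, F.E_apply]) I 1
  rw [h1] at h2
  rw [← pfOn_eq, ← pfOn_eq, ← h2, w, Pi.smul_apply, smul_eq_mul]
  congr 1
  ring

theorem pf_principal_univ {A : Type*} [Ring A] {m : ℕ}
    (M : Matrix (Fin (2 * m)) (Fin (2 * m)) A)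
    (h : (Finset.univ : Finset (Fin (2 * m))).card = 2 * m) :
    pf (principal M Finset.univ h) = pf M := by
  rw [← pfOn_eq, pfOn_univ]

theorem pf_principal_compl_univ {A : Type*} [Ring A] {N k : ℕ} (M : Matrix (Fin N) (Fin N) A)
    (h : (Finset.univᶜ : Finset (Fin N)).card = 2 * k) :
    pf (principal M Finset.univᶜ h) = 1 := by
  rw [← pfOn_eq, Finset.compl_univ, pfOn_empty]

/-! ### Rational fractions, polynomials and symbolic exponents -/

theorem pf_symplJ (A : Type*) [Ring A] (m : ℕ) : pf (symplJ A m) = 1 := by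
  induction m with
  | zero => exact pf_zero _
  | succ m ih =>
    rw [pf_succ, Finset.sum_eq_single (0 : Fin (2 * m + 1))]
    · have h1 : symplJ A (m + 1) (0 : Fin (2 * m + 1 + 1)) (Fin.succ (0 : Fin (2 * m + 1))) =
          1 := by
        simp only [symplJ, Matrix.of_apply]
        exact if_pos ⟨rfl, rfl⟩
      have h2 : ((symplJ A (m + 1)).submatrix
          (fun i : Fin (2 * m) => ((0 : Fin (2 * m + 1)).succAbove i).succ)
          (fun i => ((0 : Fin (2 * m + 1)).succAbove i).succ)) = symplJ A m := by
        ext i j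
        simp only [symplJ, Matrix.of_apply, Matrix.submatrix_apply, Fin.succAbove_zero,
          Fin.val_succ]
        congr 1
        · exact propext (by omega)
        · congr 1
          exact propext (by omega)
      rw [h1, h2, ih]
      simp
    · intro j _ hj
      have h1 : symplJ A (m + 1) (0 : Fin (2 * m + 1 + 1)) j.succ = 0 := by
        have hj' : j.1 ≠ 0 := fun h => hj (Fin.ext h)
        simp only [symplJ, Matrix.of_apply, Fin.val_succ]
        rw [if_neg (by simpa using hj'), if_neg (by simp)]
      rw [h1, zero_mul, mul_zero]
    · simp

/-- `pf (X J Xᵀ)` is not the zero polynomial when `m ≤ n`. -/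
theorem pf_symplProd_polyX_ne_zero (R : Type*) [CommRing R] [Nontrivial R] {m n : ℕ}
    (hmn : m ≤ n) : pf (symplProd (polyX R m n)) ≠ 0 := by
  intro h
  -- Evaluate at the matrix (1 | 0), which exists because m ≤ n: XJXᵀ becomes the smaller symplectic
  -- form, of pfaffian 1.
  let ev : MvPolynomial (Idx m n) R →+* R :=
    MvPolynomial.eval fun p : Idx m n => if p.1.1 = p.2.1 then (1 : R) else 0
  have h1 : (polyX R m n).map ev = Matrix.of fun i j => if i.1 = j.1 then (1 : R) else 0 := by
    ext i j
    simp [polyX, matrixOf, ev]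
  have h2 : symplProd ((polyX R m n).map ev) = symplJ R m := by
    ext a b
    have ha : a.1 < 2 * n := by omega
    have hb : b.1 < 2 * n := by omega
    rw [h1, symplProd_apply, Finset.sum_eq_single (⟨a.1, ha⟩ : Fin (2 * n)),
      Finset.sum_eq_single (⟨b.1, hb⟩ : Fin (2 * n))]
    · simp only [Matrix.of_apply, if_true, mul_one, zsmul_eq_mul]
      rw [← symplJ_eq_intCast]
      rfl
    · intro l _ hl
      have : b.1 ≠ l.1 := fun e => hl (Fin.ext e.symm)
      simp [this]
    · simp
    · intro j _ hj
      have : a.1 ≠ j.1 := fun e => hj (Fin.ext e.symm)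
      simp [this]
    · simp
  have h3 := congrArg ev h
  rw [map_pf, ← symplProd_map, h2, pf_symplJ, map_zero] at h3
  exact one_ne_zero h3

theorem locPartial_X {R S : Type*} [CommRing R] [CommRing S] {m n : ℕ}
    [Algebra (MvPolynomial (Idx m n) R) S] [Algebra R S]
    [IsScalarTower R (MvPolynomial (Idx m n) R) S] (M : Submonoid (MvPolynomial (Idx m n) R))
    [IsLocalization M S] (a : Fin (2 * m)) (j : Fin (2 * n)) (b : Fin (2 * m)) (l : Fin (2 * n)) :
    locPartial (S := S) M (a, j)
        (algebraMap _ S (MvPolynomial.X (b, l) : MvPolynomial (Idx m n) R)) =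
      if a = b ∧ j = l then 1 else 0 := by
  rw [locPartial_algebraMap, MvPolynomial.pderiv_X, Pi.single_apply]
  by_cases h : a = b ∧ j = l
  · rw [if_pos h, if_pos (by rw [h.1, h.2]), map_one]
  · rw [if_neg h, if_neg (fun e => h ⟨(Prod.mk.inj e).1.symm, (Prod.mk.inj e).2.symm⟩), map_zero]

theorem pf_symplProd_ratX_ne_zero (K : Type*) [Field K] {m n : ℕ} (hmn : m ≤ n) :
    pf (symplProd (ratX K m n)) ≠ 0 := by
  have h : pf (symplProd (ratX K m n)) =
      algebraMap (MvPolynomial (Idx m n) K) _ (pf (symplProd (polyX K m n))) := by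
    rw [map_pf, ← symplProd_map]
    rfl
  rw [h, ne_eq, IsFractionRing.to_map_eq_zero_iff]
  exact pf_symplProd_polyX_ne_zero K hmn

/-- The frame of rational fractions. -/
noncomputable def ratFrame (K : Type*) [Field K] {m n : ℕ} (hmn : m ≤ n) (s : ℤ) :
    SymplFrame K (FractionRing (MvPolynomial (Idx m n) K)) m n where
  X := ratX K m n
  d a j := locPartial (nonZeroDivisors (MvPolynomial (Idx m n) K)) (a, j)
  d_X a j b l := locPartial_X _ a j b l
  s := s
  pinv := (pf (symplProd (ratX K m n)))⁻¹
  pinv_mul := inv_mul_cancel₀ (pf_symplProd_ratX_ne_zero K hmn)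

/-- The Cayley identity for integer powers in the field of rational fractions. -/
theorem cayley_rat (K : Type*) [Field K] {m n : ℕ} (hmn : m ≤ n) (s : ℤ) {k : ℕ}
    {I : Finset (Fin (2 * m))} (hI : I.card = 2 * k) :
    pf (principal (symplProd (ratD K m n)) I hI) (pf (symplProd (ratX K m n)) ^ s) =
      cayleyFactor (s : FractionRing (MvPolynomial (Idx m n) K)) m n k *
        pf (symplProd (ratX K m n)) ^ (s - 1) *
          ((eps I : ℤ) : FractionRing (MvPolynomial (Idx m n) K)) *
            pf (principal (symplProd (ratX K m n)) Iᶜ (card_compl_eq hI)) := by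
  have hP := pf_symplProd_ratX_ne_zero K hmn
  let F := ratFrame K hmn s
  -- Multiplication by the actual power P^s turns E into the true partial derivative, by the Leibniz
  -- rule for integer powers and the logarithmic derivative -T_ja.
  have h := F.cayley_transport (AddMonoidHom.mulRight (pf (symplProd (ratX K m n)) ^ s))
    (ratD K m n) (fun a j f => by
      have h1 : F.d a j (pf (symplProd (ratX K m n))) =
        -(F.T j a * pf (symplProd (ratX K m n))) := F.d_pf a j
      have h2 : algebraMap K (FractionRing (MvPolynomial (Idx m n) K)) F.s = (s : _) :=
        map_intCast _ s
      change _ = F.d a j (f * pf (symplProd (ratX K m n)) ^ s)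
      rw [h2, Derivation.leibniz, Derivation.leibniz_zpow, h1, AddMonoidHom.coe_mulRight,
        zpow_sub_one₀ hP]
      simp only [smul_eq_mul, zsmul_eq_mul]
      field_simp
      ring) hI
  have h2 : algebraMap K (FractionRing (MvPolynomial (Idx m n) K)) F.s = (s : _) :=
    map_intCast _ s
  rw [h2, AddMonoidHom.coe_mulRight] at h
  beta_reduce at h
  rw [one_mul] at h
  rw [h, zpow_sub_one₀ hP]
  change cayleyFactor _ m n k * (pf (symplProd (ratX K m n)))⁻¹ * _ *
    pf (principal (symplProd (ratX K m n)) Iᶜ (card_compl_eq hI)) * _ = _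
  ring

theorem ratD_algebraMap (K : Type*) [Field K] {m n : ℕ} (a : Fin (2 * m)) (j : Fin (2 * n))
    (p : MvPolynomial (Idx m n) K) :
    ratD K m n a j (algebraMap _ _ p) = algebraMap _ _ (MvPolynomial.pderiv (a, j) p) :=
  locPartial_algebraMap _ _ _

/-- ℤ[x] embeds in ℚ(x) compatibly with the partial derivatives, so the rational case descends; s ≥
1 makes the natural exponent s - 1 agree with the integer one. -/
theorem cayley_int {m n : ℕ} (hmn : m ≤ n) {s : ℕ} (hs : 1 ≤ s) {k : ℕ}
    {I : Finset (Fin (2 * m))} (hI : I.card = 2 * k) :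
    pf (principal (symplProd (polyD ℤ m n)) I hI) (pf (symplProd (polyX ℤ m n)) ^ s) =
      cayleyFactor (s : MvPolynomial (Idx m n) ℤ) m n k *
        pf (symplProd (polyX ℤ m n)) ^ (s - 1) * ((eps I : ℤ) : MvPolynomial (Idx m n) ℤ) *
          pf (principal (symplProd (polyX ℤ m n)) Iᶜ (card_compl_eq hI)) := by
  let t : MvPolynomial (Idx m n) ℤ →+* FractionRing (MvPolynomial (Idx m n) ℚ) :=
    (algebraMap _ _).comp (MvPolynomial.map (Int.castRingHom ℚ))
  have ht : Function.Injective t :=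
    (IsFractionRing.injective (MvPolynomial (Idx m n) ℚ) _).comp
      (MvPolynomial.map_injective _ Int.cast_injective)
  have hX : (polyX ℤ m n).map t = ratX ℚ m n := by
    ext i j
    simp [polyX, ratX, matrixOf, t]
  have h1 := pfOn_symplProd_intertwine t.toAddMonoidHom (polyD ℤ m n) (ratD ℚ m n)
    (fun a j v => by
      refine Eq.trans ?_ (ratD_algebraMap ℚ a j _).symm
      rw [MvPolynomial.pderiv_map]
      rfl) I
      (pf (symplProd (polyX ℤ m n)) ^ s)
  apply ht
  rw [← pfOn_eq _ hI, ← pfOn_eq _ (card_compl_eq hI)]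
  refine h1.trans ?_
  simp only [RingHom.toAddMonoidHom_eq_coe, AddMonoidHom.coe_coe, map_mul, map_pow, map_pf,
    map_pfOn, ← symplProd_map, hX, map_cayleyFactor, map_natCast, map_intCast]
  have h2 := cayley_rat ℚ hmn s hI
  rw [zpow_natCast, show (s : ℤ) - 1 = ((s - 1 : ℕ) : ℤ) by omega, zpow_natCast, ← pfOn_eq,
    ← pfOn_eq] at h2
  rw [h2]
  simp

/-- The Cayley identity for positive integer powers in the polynomial ring. -/
theorem cayley_poly (R : Type*) [CommRing R] {m n : ℕ} (hmn : m ≤ n) {s : ℕ} (hs : 1 ≤ s) {k : ℕ}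
    {I : Finset (Fin (2 * m))} (hI : I.card = 2 * k) :
    pf (principal (symplProd (polyD R m n)) I hI) (pf (symplProd (polyX R m n)) ^ s) =
      cayleyFactor (s : MvPolynomial (Idx m n) R) m n k *
        pf (symplProd (polyX R m n)) ^ (s - 1) * ((eps I : ℤ) : MvPolynomial (Idx m n) R) *
          pf (principal (symplProd (polyX R m n)) Iᶜ (card_compl_eq hI)) := by
  let t : MvPolynomial (Idx m n) ℤ →+* MvPolynomial (Idx m n) R :=
    MvPolynomial.map (Int.castRingHom R)
  have hX : (polyX ℤ m n).map t = polyX R m n := by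
    ext1 i j
    simp [polyX, matrixOf, t]
  -- Partial differentiation commutes with base change ℤ → R, so the integral identity specializes
  -- to any R, torsion included.
  have h1 := pfOn_symplProd_intertwine t.toAddMonoidHom (polyD ℤ m n) (polyD R m n)
    (fun a j v => (MvPolynomial.pderiv_map (φ := Int.castRingHom R)).symm) I
      (pf (symplProd (polyX ℤ m n)) ^ s)
  have h2 := cayley_int hmn hs hI
  rw [← pfOn_eq, ← pfOn_eq] at h2
  rw [h2] at h1
  simp only [RingHom.toAddMonoidHom_eq_coe, AddMonoidHom.coe_coe, map_mul, map_pow, map_pf,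
    map_pfOn, ← symplProd_map, hX, map_cayleyFactor, map_natCast, map_intCast] at h1
  rw [← pfOn_eq, ← pfOn_eq, ← h1]

theorem pf_symplProd_symX (K : Type*) [Field K] (m n : ℕ) :
    pf (symplProd (symX K m n)) = algebraMap _ (Localization.Away (symP K m n)) (symP K m n) := by
  refine Eq.trans ?_ (map_pf (algebraMap _ (Localization.Away (symP K m n)))
    (symplProd (polyX (Polynomial K) m n))).symm
  rw [← symplProd_map]
  rfl

/-- The frame of the module `K[x, s, P⁻¹] P^s`. -/
noncomputable def symFrame (K : Type*) [Field K] (m n : ℕ) :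
    SymplFrame (Polynomial K) (Localization.Away (symP K m n)) m n where
  X := symX K m n
  d a j := locPartial (Submonoid.powers (symP K m n)) (a, j)
  d_X a j b l := locPartial_X _ a j b l
  s := Polynomial.X
  pinv := IsLocalization.Away.invSelf (symP K m n)
  pinv_mul := by
    rw [pf_symplProd_symX, mul_comm, IsLocalization.Away.mul_invSelf]

/-- The Cayley identity for a symbolic exponent. -/
theorem cayley_sym (K : Type*) [Field K] (m n : ℕ) {k : ℕ} {I : Finset (Fin (2 * m))}
    (hI : I.card = 2 * k) :
    pf (principal (symplProd (symD K m n)) I hI) (PowModule.of (symP K m n) 1) =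
      PowModule.of (symP K m n)
        (cayleyFactor (symS (symP K m n)) m n k *
          IsLocalization.Away.invSelf (symP K m n) *
            ((eps I : ℤ) : Localization.Away (symP K m n)) *
              pf (principal (symplProd (symX K m n)) Iᶜ (card_compl_eq hI))) := by
  let F := symFrame K m n
  have hs : algebraMap (Polynomial K) (Localization.Away (symP K m n)) F.s =
      symS (symP K m n) :=
    IsScalarTower.algebraMap_apply (Polynomial K) (MvPolynomial (Idx m n) (Polynomial K)) _ _
  have h := F.cayley_transport
    ({ toFun := PowModule.of (symP K m n), map_zero' := rfl, map_add' := fun _ _ => rfl } :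
      Localization.Away (symP K m n) →+ PowModule (symP K m n)) (symD K m n)
    (fun a j f => by
      have h1 := F.d_pf a j
      have h2 : pf (symplProd F.X) = algebraMap _ (Localization.Away (symP K m n)) (symP K m n) :=
        pf_symplProd_symX K m n
      have h3 : F.d a j (algebraMap _ (Localization.Away (symP K m n)) (symP K m n)) =
          algebraMap _ _ (MvPolynomial.pderiv (a, j) (symP K m n)) :=
        locPartial_algebraMap _ _ _
      have h4 := IsLocalization.Away.mul_invSelf (S := Localization.Away (symP K m n)) (symP K m n)
      rw [h2, h3] at h1
      refine Eq.trans ?_ (symPartial_of (symP K m n) (a, j) f).symm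
      refine congrArg (PowModule.of (symP K m n)) ?_
      rw [hs, h1]
      change F.d a j f - _ = F.d a j f + _
      linear_combination (symS (symP K m n) * F.T j a * f) * h4) hI
  rw [hs] at h
  exact h

/-! ### Branches of complex powers -/

section Analytic

variable {𝕜 : Type*} [RCLike 𝕜] {σ : Type*}

theorem extZero_mul {U : TopologicalSpace.Opens (σ → 𝕜)} (f g : U → ℂ) :
    extZero (f * g) = extZero f * extZero g := by
  simpa [extZero] using Function.extend_mul (Subtype.val : U → (σ → 𝕜)) f g 0 0

theorem extZero_eventuallyEq {U : TopologicalSpace.Opens (σ → 𝕜)} {g : U → ℂ} {G : (σ → 𝕜) → ℂ}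
    {x : σ → 𝕜} (hx : x ∈ U) (h : ∀ y : U, g y = G y) : extZero g =ᶠ[nhds x] G := by
  filter_upwards [U.isOpen.mem_nhds hx] with y hy
  exact (extZero_apply g ⟨y, hy⟩).trans (h ⟨y, hy⟩)

variable [NormedAlgebra 𝕜 ℂ] [Fintype σ]

theorem mem_analyticFun {U : TopologicalSpace.Opens (σ → 𝕜)} {g : U → ℂ} {G : (σ → 𝕜) → ℂ}
    (hG : ∀ x ∈ U, AnalyticAt 𝕜 G x) (h : ∀ y : U, g y = G y) : g ∈ analyticFun U := fun x hx =>
  (hG x hx).congr (extZero_eventuallyEq hx h).symm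

/-- The algebra of analytic functions on the open set `U`. -/
def analyticAlg (U : TopologicalSpace.Opens (σ → 𝕜)) : Subalgebra ℂ (U → ℂ) where
  carrier := {g | AnalyticOnNhd 𝕜 (extZero g) U}
  add_mem' {f g} hf hg := (analyticFun U).add_mem hf hg
  mul_mem' {f g} hf hg := by
    simp only [Set.mem_ofPred_eq, extZero_mul] at hf hg ⊢
    exact hf.mul hg
  algebraMap_mem' c := mem_analyticFun (G := fun _ => c) (fun _ _ => analyticAt_const)
    fun _ => rfl

theorem analyticAlg_differentiableAt {U : TopologicalSpace.Opens (σ → 𝕜)} (f : analyticAlg U)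
    (x : U) : DifferentiableAt 𝕜 (extZero f.1) x.1 := (f.2 x.1 x.2).differentiableAt

/-- The coordinate function `x_i`. -/
noncomputable def analyticX (U : TopologicalSpace.Opens (σ → 𝕜)) (i : σ) : analyticAlg U :=
  ⟨fun x => algebraMap 𝕜 ℂ (x.1 i), mem_analyticFun
    (G := (Algebra.linearMap 𝕜 ℂ).toContinuousLinearMap.comp (ContinuousLinearMap.proj i))
    (fun _ _ => ContinuousLinearMap.analyticAt _ _) fun _ => rfl⟩

theorem exists_inv_analytic {U : TopologicalSpace.Opens (σ → 𝕜)} (p : analyticAlg U)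
    (hp : ∀ x, p.1 x ≠ 0) : ∃ q : analyticAlg U, q * p = 1 := by
  refine ⟨⟨fun x => (p.1 x)⁻¹, mem_analyticFun (G := fun y => (extZero p.1 y)⁻¹)
    (fun x hx => ?_) fun y => by rw [extZero_apply]⟩, ?_⟩
  · refine (p.2 x hx).inv ?_
    rw [extZero_apply p.1 ⟨x, hx⟩]
    exact hp _
  · ext x
    exact inv_mul_cancel₀ (hp x)

/-- Near a point of `U`, a branch of `P^s` is `exp (s (L₀ + log (P / P₀)))`. -/
theorem IsPowBranch.eventuallyEq {U : TopologicalSpace.Opens (σ → 𝕜)} {p : analyticAlg U} {s : ℂ}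
    {F : U → ℂ} (hF : IsPowBranch p.1 s F) (x : U) {L : ℂ} (hL : Complex.exp L = p.1 x)
    (hFL : F x = Complex.exp (s * L)) :
    extZero F =ᶠ[nhds x.1]
      fun y => Complex.exp (s * (L + Complex.log (extZero p.1 y / p.1 x))) := by
  have hp0 : p.1 x ≠ 0 := hL ▸ Complex.exp_ne_zero L
  set ℓ : (σ → 𝕜) → ℂ := fun y => L + Complex.log (extZero p.1 y / p.1 x) with hℓ
  have hslit : ∀ᶠ y in nhds x.1, extZero p.1 y / p.1 x ∈ Complex.slitPlane := by
    have hc : ContinuousAt (fun y => extZero p.1 y / p.1 x) x.1 :=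
      (p.2 x.1 x.2).continuousAt.div_const _
    refine hc.eventually_mem (Complex.isOpen_slitPlane.mem_nhds ?_)
    rw [extZero_apply, div_self hp0]
    exact Complex.one_mem_slitPlane
  obtain ⟨r, hr, hball⟩ := Metric.eventually_nhds_iff_ball.1
    (hslit.and (U.isOpen.mem_nhds x.2))
  have hFc : ContinuousOn (extZero F) (Metric.ball x.1 r) := by
    intro y hy
    have hyU : y ∈ U := (hball y hy).2
    have h1 : ContinuousOn (extZero F) U := by
      rw [continuousOn_iff_continuous_domRestrict]
      exact hF.1.congr fun z => (extZero_apply F z).symm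
    exact ((h1 y hyU).continuousAt (U.isOpen.mem_nhds hyU)).continuousWithinAt
  have hℓc : ContinuousOn ℓ (Metric.ball x.1 r) := by
    intro y hy
    refine ContinuousAt.continuousWithinAt (continuousAt_const.add ?_)
    exact ((p.2 y (hball y hy).2).continuousAt.div_const _).clog (hball y hy).1
  have hexp : ∀ y ∈ Metric.ball x.1 r, Complex.exp (ℓ y) = extZero p.1 y := by
    intro y hy
    rw [hℓ, Complex.exp_add, Complex.exp_log (Complex.slitPlane_ne_zero (hball y hy).1), hL,
      mul_div_cancel₀ _ hp0]
  -- The quotient of F by the explicit local branch is continuous on a ball and takes values in a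
  -- countable set, as two logarithms of P differ by a multiple of 2πi. A connected subset of a
  -- countable set has at most one point, so q is constant, equal to its value 1 at the centre.
  set q : (σ → 𝕜) → ℂ := fun y => extZero F y * Complex.exp (-(s * ℓ y)) with hq
  have hqc : ContinuousOn q (Metric.ball x.1 r) :=
    hFc.mul (Complex.continuous_exp.comp_continuousOn (continuousOn_const.mul hℓc).neg)
  have hqval : q '' Metric.ball x.1 r ⊆
      Set.range fun k : ℤ => Complex.exp (s * (k * (2 * Real.pi * Complex.I))) := by
    rintro _ ⟨y, hy, rfl⟩
    obtain ⟨L', hL', hF'⟩ := hF.2 ⟨y, (hball y hy).2⟩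
    have h1 : Complex.exp L' = Complex.exp (ℓ y) := by
      rw [hL', hexp y hy, ← extZero_apply p.1 ⟨y, (hball y hy).2⟩]
    obtain ⟨k, hk⟩ := Complex.exp_eq_exp_iff_exists_int.1 h1
    refine ⟨k, ?_⟩
    have h2 : extZero F y = Complex.exp (s * L') :=
      (extZero_apply F ⟨y, (hball y hy).2⟩).trans hF'
    simp only [hq]
    rw [h2, ← Complex.exp_add, hk]
    congr 1
    ring
  have hsub : (q '' Metric.ball x.1 r).Subsingleton :=
    ((Set.countable_range _).mono hqval).isTotallyDisconnected _ subset_rfl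
      ((Metric.isPreconnected_ball (x := x.1) (r := r)).image q hqc)
  have hqx : q x.1 = 1 := by
    have hℓx : ℓ x.1 = L := by
      rw [hℓ]
      simp [extZero_apply, div_self hp0]
    simp only [hq]
    rw [hℓx, extZero_apply, hFL, ← Complex.exp_add]
    simp
  filter_upwards [Metric.ball_mem_nhds x.1 hr] with y hy
  have h1 : q y = 1 :=
    (hsub ⟨y, hy, rfl⟩ ⟨x.1, Metric.mem_ball_self hr, rfl⟩).trans hqx
  simp only [hq] at h1
  rw [Complex.exp_neg, ← div_eq_mul_inv, div_eq_one_iff_eq (Complex.exp_ne_zero _)] at h1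
  exact h1

theorem IsPowBranch.mem_analyticFun {U : TopologicalSpace.Opens (σ → 𝕜)} {p : analyticAlg U}
    {s : ℂ} {F : U → ℂ} (hF : IsPowBranch p.1 s F) : F ∈ analyticFun U := by
  intro x hx
  obtain ⟨L, hL, hFL⟩ := hF.2 ⟨x, hx⟩
  refine AnalyticAt.congr ?_ (hF.eventuallyEq ⟨x, hx⟩ hL hFL).symm
  have hp0 : p.1 ⟨x, hx⟩ ≠ 0 := hL ▸ Complex.exp_ne_zero L
  have h1 : AnalyticAt ℂ (fun z => Complex.exp (s * (L + Complex.log (z / p.1 ⟨x, hx⟩))))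
      (extZero p.1 x) := by
    rw [extZero_apply p.1 ⟨x, hx⟩]
    refine AnalyticAt.cexp (analyticAt_const.mul (analyticAt_const.add ?_))
    refine AnalyticAt.clog (analyticAt_id.div analyticAt_const hp0) ?_
    simp [div_self hp0]
  exact (h1.restrictScalars (𝕜 := 𝕜)).comp (p.2 x hx)

variable [DecidableEq σ]

/-- `∂/∂x_i` as a derivation of the algebra of analytic functions on `U`. -/
noncomputable def analyticD (U : TopologicalSpace.Opens (σ → 𝕜)) (i : σ) :
    Derivation ℂ (analyticAlg U) (analyticAlg U) :=
  Derivation.mk'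
    { toFun := fun g => ⟨partialFun i g.1, (anPartial U i ⟨g.1, g.2⟩).2⟩
      map_add' := fun f g => by
        ext x
        change fderiv 𝕜 (extZero (f.1 + g.1)) x.1 _ = _
        rw [extZero_add, fderiv_add (analyticAlg_differentiableAt f x)
          (analyticAlg_differentiableAt g x)]
        rfl
      map_smul' := fun c g => by
        ext x
        have h : extZero (c • g.1) =ᶠ[nhds x.1] fun y => c * extZero g.1 y :=
          extZero_eventuallyEq x.2 fun y => by rw [extZero_apply]; rfl
        change fderiv 𝕜 (extZero (c • g.1)) x.1 _ = _
        rw [h.fderiv_eq, fderiv_const_mul (analyticAlg_differentiableAt g x)]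
        rfl }
    (fun f g => by
      ext x
      change fderiv 𝕜 (extZero (f.1 * g.1)) x.1 _ = _
      rw [extZero_mul, fderiv_mul (analyticAlg_differentiableAt f x)
        (analyticAlg_differentiableAt g x)]
      simp only [extZero_apply]
      rfl)

theorem analyticD_apply {U : TopologicalSpace.Opens (σ → 𝕜)} (i : σ) (f : analyticAlg U) (x : U) :
    (analyticD U i f).1 x = fderiv 𝕜 (extZero f.1) x.1 (Pi.single i 1) := rfl

theorem analyticD_analyticX (U : TopologicalSpace.Opens (σ → 𝕜)) (i k : σ) :
    analyticD U i (analyticX U k) = if i = k then 1 else 0 := by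
  ext x
  have h : extZero (analyticX U k).1 =ᶠ[nhds x.1]
      ((Algebra.linearMap 𝕜 ℂ).toContinuousLinearMap.comp
        (ContinuousLinearMap.proj (R := 𝕜) (φ := fun _ : σ => 𝕜) k)) :=
    extZero_eventuallyEq x.2 fun _ => rfl
  rw [analyticD_apply, h.fderiv_eq, ContinuousLinearMap.fderiv]
  by_cases hik : i = k
  · subst hik
    simp
  · simp [hik, Ne.symm hik]

/-- Differentiating the local formula by the chain rule gives F' = s F P'/P; clearing the
denominator keeps the equation inside the algebra of analytic functions. -/
theorem IsPowBranch.analyticD_eq {U : TopologicalSpace.Opens (σ → 𝕜)} {p : analyticAlg U}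
    {s : ℂ} {F : analyticAlg U} (hF : IsPowBranch p.1 s F.1) (i : σ) (x : U) :
    (analyticD U i F).1 x * p.1 x = s * F.1 x * (analyticD U i p).1 x := by
  obtain ⟨L, hL, hFL⟩ := hF.2 x
  have hp0 : p.1 x ≠ 0 := hL ▸ Complex.exp_ne_zero L
  have h1 : HasDerivAt (fun z => Complex.exp (s * (L + Complex.log (z / p.1 x))))
      (Complex.exp (s * L) * (s * (p.1 x)⁻¹)) (p.1 x) := by
    have h2 : HasDerivAt (fun z : ℂ => Complex.log (z / p.1 x)) ((p.1 x)⁻¹) (p.1 x) := by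
      have := ((hasDerivAt_id (p.1 x)).div_const (p.1 x)).clog (by simp [div_self hp0])
      simpa [div_self hp0] using this
    have h3 := ((h2.const_add L).const_mul s).cexp
    simpa [div_self hp0] using h3
  have h4 := h1.comp_hasFDerivAt_of_eq (f := extZero p.1) x.1
    (analyticAlg_differentiableAt p x).hasFDerivAt (extZero_apply p.1 x).symm
  have h5 := (h4.congr_of_eventuallyEq (hF.eventuallyEq x hL hFL)).fderiv
  rw [analyticD_apply, analyticD_apply, h5, hFL, smul_apply, smul_eq_mul]
  field_simp

end Analytic

/-- The Cayley identity for branches of complex powers. -/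
theorem cayley_analytic {𝕜 : Type*} [RCLike 𝕜] [NormedAlgebra 𝕜 ℂ] {m n : ℕ}
    {U : TopologicalSpace.Opens (Idx m n → 𝕜)} {s : ℂ} {F : U → ℂ} (hF : IsPowBranch (anP U) s F) :
    ∃ hF : F ∈ analyticFun U, ∀ (k : ℕ) (I : Finset (Fin (2 * m))) (hI : I.card = 2 * k) (x : U),
      (pf (principal (symplProd (anD U)) I hI) ⟨F, hF⟩).1 x =
        cayleyFactor s m n k * (F x / anP U x) * ((eps I : ℤ) : ℂ) *
          pf (principal (symplProd (anX x.1)) Iᶜ (card_compl_eq hI)) := by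
  let X : Matrix (Fin (2 * m)) (Fin (2 * n)) (analyticAlg U) := matrixOf (analyticX U)
  let p : analyticAlg U := pf (symplProd X)
  let ev : U → (analyticAlg U →+* ℂ) := fun x => (Pi.evalRingHom (fun _ => ℂ) x).comp
    (analyticAlg U).val.toRingHom
  have hX : ∀ x, (symplProd X).map (ev x) = symplProd (anX x.1) := fun x => by
    rw [← symplProd_map]
    rfl
  have hp : p.1 = anP U := funext fun x => by
    change ev x (pf (symplProd X)) = _
    rw [map_pf, hX]
    rfl
  rw [← hp] at hF ⊢
  have hp0 : ∀ x, p.1 x ≠ 0 := fun x => by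
    obtain ⟨L, hL, -⟩ := hF.2 x
    exact hL ▸ Complex.exp_ne_zero L
  obtain ⟨q, hq⟩ := exists_inv_analytic p hp0
  have hFm := hF.mem_analyticFun
  let Fa : analyticAlg U := ⟨F, hFm⟩
  -- The frame lives over ℂ even for real matrices, because the constant s is complex.
  let Fr : SymplFrame ℂ (analyticAlg U) m n :=
    { X := X
      d := fun a j => analyticD U (a, j)
      d_X := fun a j b l => by
        change analyticD U (a, j) (analyticX U (b, l)) = _
        rw [analyticD_analyticX]
        simp only [Prod.mk.injEq]
      s := s
      pinv := q
      pinv_mul := hq }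
  refine ⟨hFm, fun k I hI x => ?_⟩
  -- This is f ↦ f F; additivity is all the transport needs, so the two sides may be modules over ℂ
  -- and over 𝕜.
  let t : analyticAlg U →+ analyticFun U :=
    { toFun := fun f => ⟨(f * Fa).1, (f * Fa).2⟩
      map_zero' := by
        ext x
        simp
      map_add' := fun f g => by
        ext x
        simp [add_mul] }
  have ht1 : t 1 = ⟨F, hFm⟩ := by
    ext x
    simp [t, Fa]
  have h := Fr.cayley_transport t (anD U) (fun a j f => by
    have h1 : analyticD U (a, j) p = -(Fr.T j a * p) := Fr.d_pf a j
    have h2 : analyticD U (a, j) (f * Fa) = f * analyticD U (a, j) Fa + Fa * analyticD U (a, j) f :=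
      Derivation.leibniz _ _ _
    have h3 : analyticD U (a, j) Fa = -(algebraMap ℂ _ s * Fr.T j a * Fa) := by
      apply Subtype.ext
      funext y
      refine mul_right_cancel₀ (hp0 y) ((hF.analyticD_eq (F := Fa) (a, j) y).trans ?_)
      rw [h1]
      change s * Fa.1 y * -((Fr.T j a).1 y * p.1 y) = -(s * (Fr.T j a).1 y * Fa.1 y) * p.1 y
      ring
    have h4 : (analyticD U (a, j) f - algebraMap ℂ _ s * Fr.T j a * f) * Fa =
        analyticD U (a, j) (f * Fa) := by
      rw [h2, h3]
      ring
    exact Subtype.ext (congrArg Subtype.val h4)) hI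
  have hqx : q.1 x = (p.1 x)⁻¹ := by
    have := congrFun (congrArg Subtype.val hq) x
    exact eq_inv_of_mul_eq_one_left this
  rw [ht1] at h
  rw [h]
  change ev x (cayleyFactor (algebraMap ℂ _ s) m n k * q * ((eps I : ℤ) : analyticAlg U) *
    pf (principal (symplProd X) Iᶜ (card_compl_eq hI))) * F x = _
  rw [← pfOn_eq, ← pfOn_eq, map_mul, map_mul, map_mul, map_cayleyFactor, map_intCast, map_pfOn, hX]
  change cayleyFactor s m n k * q.1 x * _ * _ * F x = _
  rw [hqx]
  ring

end RectCayley

open RectCayley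

theorem theorem2p8 (m n : ℕ) (hmn : m ≤ n) :
    -- positive integer exponents, in the polynomial ring `R[x]` over any commutative ring `R`
    (∀ (R : Type*) [CommRing R] (s : ℕ), 1 ≤ s →
      pf (symplProd (polyD R m n)) (pf (symplProd (polyX R m n)) ^ s) =
          cayleyFactor (s : MvPolynomial (Idx m n) R) m n m *
            pf (symplProd (polyX R m n)) ^ (s - 1) ∧
      ∀ (k : ℕ) (I : Finset (Fin (2 * m))) (hI : I.card = 2 * k),
        pf (principal (symplProd (polyD R m n)) I hI) (pf (symplProd (polyX R m n)) ^ s) =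
          cayleyFactor (s : MvPolynomial (Idx m n) R) m n k *
            pf (symplProd (polyX R m n)) ^ (s - 1) *
              ((eps I : ℤ) : MvPolynomial (Idx m n) R) *
                pf (principal (symplProd (polyX R m n)) Iᶜ (card_compl_eq hI))) ∧
    -- arbitrary integer exponents, in the field `K(x)` of rational fractions over any field `K`
    (∀ (K : Type*) [Field K] (s : ℤ),
      pf (symplProd (ratD K m n)) (pf (symplProd (ratX K m n)) ^ s) =
          cayleyFactor (s : FractionRing (MvPolynomial (Idx m n) K)) m n m *
            pf (symplProd (ratX K m n)) ^ (s - 1) ∧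
      ∀ (k : ℕ) (I : Finset (Fin (2 * m))) (hI : I.card = 2 * k),
        pf (principal (symplProd (ratD K m n)) I hI) (pf (symplProd (ratX K m n)) ^ s) =
          cayleyFactor (s : FractionRing (MvPolynomial (Idx m n) K)) m n k *
            pf (symplProd (ratX K m n)) ^ (s - 1) *
              ((eps I : ℤ) : FractionRing (MvPolynomial (Idx m n) K)) *
                pf (principal (symplProd (ratX K m n)) Iᶜ (card_compl_eq hI))) ∧
    -- symbolic exponent `s`, in the module `K[x, s, P⁻¹] P^s` with `P = pf (X J Xᵀ)`;
    -- `P^s` is `1 P^s` and `P^(s-1)` is `P⁻¹ P^s`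
    (∀ (K : Type*) [Field K] [CharZero K],
      pf (symplProd (symD K m n)) (PowModule.of (symP K m n) 1) =
          PowModule.of (symP K m n)
            (cayleyFactor (symS (symP K m n)) m n m *
              IsLocalization.Away.invSelf (symP K m n)) ∧
      ∀ (k : ℕ) (I : Finset (Fin (2 * m))) (hI : I.card = 2 * k),
        pf (principal (symplProd (symD K m n)) I hI) (PowModule.of (symP K m n) 1) =
          PowModule.of (symP K m n)
            (cayleyFactor (symS (symP K m n)) m n k *
              IsLocalization.Away.invSelf (symP K m n) *
                ((eps I : ℤ) : Localization.Away (symP K m n)) *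
                  pf (principal (symplProd (symX K m n)) Iᶜ (card_compl_eq hI)))) ∧
    -- complex exponent `s`, for any branch `F` of `P^s` on any open set `U` of real or complex
    -- matrices; `F` is analytic, and the corresponding branch of `P^(s-1)` is `P⁻¹ F`
    (∀ (𝕜 : Type) [RCLike 𝕜] [NormedAlgebra 𝕜 ℂ] (U : TopologicalSpace.Opens (Idx m n → 𝕜))
        (s : ℂ) (F : U → ℂ), IsPowBranch (anP U) s F →
      ∃ hF : F ∈ analyticFun U,
        (∀ x : U, (pf (symplProd (anD U)) ⟨F, hF⟩).1 x =
          cayleyFactor s m n m * (F x / anP U x)) ∧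
        ∀ (k : ℕ) (I : Finset (Fin (2 * m))) (hI : I.card = 2 * k) (x : U),
          (pf (principal (symplProd (anD U)) I hI) ⟨F, hF⟩).1 x =
            cayleyFactor s m n k * (F x / anP U x) * ((eps I : ℤ) : ℂ) *
              pf (principal (symplProd (anX x.1)) Iᶜ (card_compl_eq hI))) := by
  have huniv : (Finset.univ : Finset (Fin (2 * m))).card = 2 * m := by simp
  refine ⟨fun R _ s hs => ⟨?_, fun k I hI => cayley_poly R hmn hs hI⟩,
    fun K _ s => ⟨?_, fun k I hI => cayley_rat K hmn s hI⟩,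
    fun K _ _ => ⟨?_, fun k I hI => cayley_sym K m n hI⟩,
    fun 𝕜 _ _ U s F hF => ?_⟩
  -- The full pfaffian is the case I = [2m], k = m: ε(I) = 1 and the complementary pfaffian is
  -- empty, hence 1.
  · simpa only [pf_principal_univ, pf_principal_compl_univ, eps_univ, Int.cast_one, mul_one]
      using cayley_poly R hmn hs huniv
  · simpa only [pf_principal_univ, pf_principal_compl_univ, eps_univ, Int.cast_one, mul_one]
      using cayley_rat K hmn s huniv
  · simpa only [pf_principal_univ, pf_principal_compl_univ, eps_univ, Int.cast_one, mul_one]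
      using cayley_sym K m n huniv
  · obtain ⟨hFm, h⟩ := cayley_analytic hF
    refine ⟨hFm, fun x => ?_, h⟩
    simpa only [pf_principal_univ, pf_principal_compl_univ, eps_univ, Int.cast_one, mul_one]
      using h m Finset.univ huniv x
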